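/- **Setting.** Let $n\ge 0$ be an integer and let $\{\xi(m):m\in\mathbb Z\}$ be a (complex-valued) stochastic sequence on a probability space whose increments $$\xi^{(n)}(m,\mu)=\sum_{l=0}^{n}(-1)^l\binom nl\,\xi(m-l\mu),\qquad m,\mu\in\mathbb Z,$$ are square integrable, have mean $0$, and are wide sense stationary: $\mathsf E\,\xi^{(n)}(m_0+m,\mu_1)\overline{\xi^{(n)}(m_0,\mu_2)}$ does not depend on $m_0$. Suppose that the spectral function is absolutely continuous with spectral density $f$, i.e. $$\mathsf E\,\xi^{(n)}(m_0+m,\mu_1)\overline{\xi^{(n)}(m_0,\mu_2)}=\int_{-\pi}^{\pi}e^{i\lambda m}(1-e^{-i\mu_1\lambda})^n(1-e^{i\mu_2\lambda})^n\lambda^{-2n}f(\lambda)\,d\lambda ,$$ and that $f$ admits the canonical factorization $f(\lambda)=|\Phi(e^{-i\lambda})|^2$ for a.e. $\lambda\in[-\pi,\pi)$, where $\Phi(z)=\sum_{k\ge0}\varphi(k)z^k$ has radius of convergence $>1$ and no zeros in $\{|z|\le1\}$. Fix an integer step $\mu>0$ and complex numbers $b_\mu(k)$, $k\ge0$, with $\sum_k|b_\mu(k)|<\infty$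 and $\sum_k(k+1)|b_\mu(k)|^2<\infty$. Let $H^t(\xi^{(n)})\subset L_2(\mathsf P)$ be the closed linear span of all $\xi^{(n)}(m,\mu')$, $m\le t$, $\mu'>0$. A *canonical representation* (with step $\mu$) is $$\xi^{(n)}(m,\mu)=\sum_{k\ge0}\varphi_\mu(k)\,\varepsilon(m-k),\quad m\in\mathbb Z,\qquad \varphi_\mu\in\ell_2,$$ where the $\varepsilon(m)$ are uncorrelated with mean $0$ and variance $1$, and $H^t(\xi^{(n)})$ is the closed span of $\{\varepsilon(m):m\le t\}$ for every $t\in\mathbb Z$. A *spectral representation* is an orthogonal stochastic measure $Z$ on $[-\pi,\pi)$ with $\mathsf E Z(A_1)\overline{Z(A_2)}=\int_{A_1\cap A_2}f\,d\lambda$ and $\xi^{(n)}(m,\mu')=\int_{-\pi}^{\pi}e^{i\lambda m}(1-e^{-i\mu'\lambda})^n(i\lambda)^{-n}dZ(\lambda)$ for all $m,\mu'\in\mathbb Z$. **Theorem 3.1.** Spectral representations and canonical representations exist. The matrix with entries $b_\mu(k+j)$, $k,j\ge0$, defines a bounded (Hankel) operator $B^\mu$ on $\ell_2$, and the series $B\xi=\sum_{k\ge0}b_\mu(k)\xi^{(n)}(k,\mu)$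 converges in mean square. There is exactly one mean square optimal linear estimate $\hat B\xi$ of $B\xi$ from the observed increments $\xi^{(n)}(m,\mu)$, $m\le-1$, i.e. one minimizer of $\mathsf E|B\xi-Y|^2$ over the closed linear span of these increments; it is also optimal in the larger class $H^{-1}(\xi^{(n)})$ of estimates from the increments of all steps $\mu'>0$ formed from $\xi(m)$, $m\le-1$. For every canonical representation $(\varepsilon,\varphi_\mu)$ and every spectral representation $Z$, put $$\Phi_\mu(e^{-i\lambda})=\sum_{k\ge0}\varphi_\mu(k)e^{-i\lambda k},\quad B^\mu(e^{i\lambda})=\sum_{k\ge0}b_\mu(k)e^{i\lambda k},\quad r_\mu(e^{i\lambda})=\sum_{j\ge0}(B^\mu\varphi_\mu)_j\,e^{i\lambda j}$$ (sums in $L_2(-\pi,\pi)$). Then $\Phi_\mu(e^{-i\lambda})\ne0$ for a.e. $\lambda$, and $$\hat B\xi=\int_{-\pi}^{\pi}h_\mu(\lambda)(1-e^{-i\lambda\mu})^n\frac{1}{(i\lambda)^n}\,dZ(\lambda)$$ holds (with integrand in $L_2(f)$) for $$h_\mu(\lambda)=B^\mu(e^{i\lambda})-r_\mu(e^{i\lambda})\,\Phi_\mu^{-1}(e^{-i\lambda})$$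 and, up to equality almost everywhere, for no other function $h_\mu$. The mean square error is $$\mathsf E|B\xi-\hat B\xi|^2=\frac1{2\pi}\int_{-\pi}^{\pi}|r_\mu(e^{i\lambda})|^2\,d\lambda=\|B^\mu\varphi_\mu\|_{\ell_2}^2 .$$ -/

import Mathlib

open MeasureTheory Filter Topology
open scoped ENNReal ComplexConjugate

noncomputable section

namespace StatIncr

/-- The space `ℓ₂` of square summable complex sequences indexed by `k = 0, 1, 2, …`. -/
abbrev EllTwo : Type := lp (fun _ : ℕ => ℂ) 2

/-! ### Increment sequences -/

/-- The `n`-th increment `ξ⁽ⁿ⁾(m, μ) = ∑_{l=0}^{n} (-1)^l C(n,l) ξ(m - l μ)` with step `μ`. -/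
def incr {Ω : Type*} (ξ : ℤ → Ω → ℂ) (n : ℕ) (m μ : ℤ) : Ω → ℂ := fun ω =>
  ∑ l ∈ Finset.range (n + 1), (-1 : ℂ) ^ l * (n.choose l : ℂ) * ξ (m - l * μ) ω

/-- `ξ` is a stochastic sequence with wide sense stationary `n`-th increments: the increments
are square integrable, and their first moments and mixed second moments do not depend on the
base point `m₀`. -/
structure StationaryIncrements {Ω : Type*} [MeasurableSpace Ω] (P : Measure Ω)
    (ξ : ℤ → Ω → ℂ) (n : ℕ) : Prop where
  aemeasurable : ∀ m : ℤ, AEMeasurable (ξ m) P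
  memLp : ∀ m μ : ℤ, MemLp (incr ξ n m μ) 2 P
  mean : ∃ c : ℤ → ℂ, ∀ m₀ μ : ℤ, ∫ ω, incr ξ n m₀ μ ω ∂P = c μ
  structural : ∃ D : ℤ → ℤ → ℤ → ℂ, ∀ m₀ m μ₁ μ₂ : ℤ,
    ∫ ω, incr ξ n (m₀ + m) μ₁ ω * conj (incr ξ n m₀ μ₂ ω) ∂P = D m μ₁ μ₂

/-- The function `(1 - e^{-iμx})^n / (ix)^n`, with its limit `μ^n` as value at `x = 0`. -/
def incrKernel (n : ℕ) (μ : ℤ) (x : ℝ) : ℂ :=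
  if x = 0 then (μ : ℂ) ^ n
  else (1 - Complex.exp (-(Complex.I * μ * x))) ^ n / (Complex.I * x) ^ n

/-- The measure on `[-π, π)` with density `f` with respect to Lebesgue measure, i.e. the measure
`dF` of the absolutely continuous spectral function `F` with spectral density `f`. -/
def densityMeasure (f : ℝ → ℝ) : Measure ℝ :=
  (volume.restrict (Set.Ico (-Real.pi) Real.pi)).withDensity fun x => ENNReal.ofReal (f x)

/-- `F` is the spectral measure of the increments of `ξ`: the structural function is
`D(m, μ₁, μ₂) = ∫ e^{ixm} (1 - e^{-iμ₁x})^n (1 - e^{iμ₂x})^n x^{-2n} dF(x)`. -/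
def IsSpectralMeasure {Ω : Type*} [MeasurableSpace Ω] (P : Measure Ω)
    (ξ : ℤ → Ω → ℂ) (n : ℕ) (F : Measure ℝ) : Prop :=
  IsFiniteMeasure F ∧ F (Set.Ico (-Real.pi) Real.pi)ᶜ = 0 ∧
  ∀ m₀ m μ₁ μ₂ : ℤ,
    ∫ ω, incr ξ n (m₀ + m) μ₁ ω * conj (incr ξ n m₀ μ₂ ω) ∂P =
      ∫ x : ℝ, Complex.exp (Complex.I * m * x) *
        (incrKernel n μ₁ x * conj (incrKernel n μ₂ x)) ∂F

/-- The canonical factorization `f(x) = |Φ(e^{-ix})|²` on `[-π, π)`, where the power series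
`Φ(z) = ∑ φ(k) z^k` has radius of convergence greater than one and no zeros in the closed
unit disk. -/
def IsCanonicalFactorization (f : ℝ → ℝ) (φ : ℕ → ℂ) : Prop :=
  (∃ r : ℝ, 1 < r ∧ Summable fun k => ‖φ k‖ * r ^ k) ∧
  (∀ z : ℂ, ‖z‖ ≤ 1 → ∑' k, φ k * z ^ k ≠ 0) ∧
  ∀ᵐ x ∂(volume.restrict (Set.Ico (-Real.pi) Real.pi)),
    f x = ‖∑' k, φ k * Complex.exp (-(Complex.I * x)) ^ k‖ ^ 2

/-! ### Subspaces of `L₂(P)` and the canonical moving average representation -/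

section Spaces

variable {Ω : Type*} [MeasurableSpace Ω] {P : Measure Ω} {ξ : ℤ → Ω → ℂ} {n : ℕ}

/-- The increment `ξ⁽ⁿ⁾(m, μ)` as an element of `L₂(P)`. -/
def StationaryIncrements.incrLp (h : StationaryIncrements P ξ n) (m μ : ℤ) : Lp ℂ 2 P :=
  (h.memLp m μ).toLp (incr ξ n m μ)

/-- The closed span of the increments `ξ⁽ⁿ⁾(m, μ)`, `m ≤ t`, with one fixed step `μ`. -/
def StationaryIncrements.obsSpace (h : StationaryIncrements P ξ n) (μ t : ℤ) :
    Submodule ℂ (Lp ℂ 2 P) :=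
  (Submodule.span ℂ {X | ∃ m : ℤ, m ≤ t ∧ X = h.incrLp m μ}).topologicalClosure

/-- The space `H^t(ξ⁽ⁿ⁾)`: the closed span of the increments `ξ⁽ⁿ⁾(m, μ)`, `m ≤ t`, with all
steps `μ > 0`. -/
def StationaryIncrements.pastSpace (h : StationaryIncrements P ξ n) (t : ℤ) :
    Submodule ℂ (Lp ℂ 2 P) :=
  (Submodule.span ℂ {X | ∃ m μ : ℤ, m ≤ t ∧ 0 < μ ∧ X = h.incrLp m μ}).topologicalClosure

/-- `ε` is an innovation sequence: uncorrelated variables with mean zero and variance one such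
that `H^t(ξ⁽ⁿ⁾) = H^t(ε)` for all `t`. -/
structure IsInnovation (h : StationaryIncrements P ξ n) (ε : ℤ → Lp ℂ 2 P) : Prop where
  mean_zero : ∀ m, ∫ ω, ε m ω ∂P = 0
  uncorrelated : ∀ m k, ∫ ω, ε m ω * conj (ε k ω) ∂P = if m = k then 1 else 0
  past_eq : ∀ t : ℤ, h.pastSpace t =
    (Submodule.span ℂ {X | ∃ m : ℤ, m ≤ t ∧ X = ε m}).topologicalClosure

/-- The canonical moving average representation
`ξ⁽ⁿ⁾(m, μ) = ∑_{k ≥ 0} φ_μ(k) ε(m - k)`, `m ∈ ℤ`, where `ε` is an innovation sequence and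
`φ_μ` is square summable; the series converges in mean square. -/
structure IsCanonicalRepresentation (h : StationaryIncrements P ξ n) (μ : ℤ)
    (ε : ℤ → Lp ℂ 2 P) (φμ : EllTwo) : Prop where
  innovation : IsInnovation h ε
  hasSum : ∀ m : ℤ, HasSum (fun k : ℕ => φμ k • ε (m - k)) (h.incrLp m μ)

/-- The mean square error `E|X - Y|²`. -/
def mse (X Y : Lp ℂ 2 P) : ℝ := ∫ ω, ‖X ω - Y ω‖ ^ 2 ∂P

/-- `Y` is a mean square optimal estimate of `X` among the elements of `K`. -/
def IsOptimalEstimate (K : Submodule ℂ (Lp ℂ 2 P)) (X Y : Lp ℂ 2 P) : Prop :=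
  Y ∈ K ∧ ∀ W ∈ K, mse X Y ≤ mse X W

/-! ### Orthogonal stochastic measures and the stochastic integral -/

/-- `Z` is an orthogonal stochastic measure with `E Z(A) conj Z(B) = F(A ∩ B)`. (Additivity and
countable additivity in mean square follow from this identity.) -/
def IsOrthogonalStochasticMeasure (F : Measure ℝ) (Z : Set ℝ → Lp ℂ 2 P) : Prop :=
  ∀ A B : Set ℝ, MeasurableSet A → MeasurableSet B →
    ∫ ω, Z A ω * conj (Z B ω) ∂P = (F.real (A ∩ B) : ℂ)

/-- The stochastic integral of a simple function: the sum of `c Z({s = c})` over its values. -/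
def simpleStochIntegral (Z : Set ℝ → Lp ℂ 2 P) (s : SimpleFunc ℝ ℂ) : Lp ℂ 2 P :=
  ∑ c ∈ s.range, c • Z (s ⁻¹' {c})

/-- `X = ∫ g dZ`: the function `g` is in `L₂(F)`, and `X` is the mean square limit of the
integrals of simple functions which converge to `g` in `L₂(F)`. -/
def HasStochIntegral (F : Measure ℝ) (Z : Set ℝ → Lp ℂ 2 P) (g : ℝ → ℂ) (X : Lp ℂ 2 P) : Prop :=
  MemLp g 2 F ∧ ∃ s : ℕ → SimpleFunc ℝ ℂ,
    Tendsto (fun N => eLpNorm (fun x => g x - s N x) 2 F) atTop (𝓝 0) ∧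
    Tendsto (fun N => simpleStochIntegral Z (s N)) atTop (𝓝 X)

/-- `Z` is an orthogonal stochastic measure with structure measure `F` that gives the spectral
representation `ξ⁽ⁿ⁾(m, μ) = ∫ e^{ixm} (1 - e^{-iμx})^n (ix)^{-n} dZ(x)` for all `m, μ ∈ ℤ`. -/
structure IsSpectralRepresentation (h : StationaryIncrements P ξ n) (F : Measure ℝ)
    (Z : Set ℝ → Lp ℂ 2 P) : Prop where
  orthogonal : IsOrthogonalStochasticMeasure F Z
  repr : ∀ m μ : ℤ, HasStochIntegral F Z
    (fun x => Complex.exp (Complex.I * m * x) * incrKernel n μ x) (h.incrLp m μ)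

/-- `g` is a spectral characteristic of `X`: `X = ∫ g(x) (1 - e^{-iμx})^n (ix)^{-n} dZ(x)`. -/
def IsSpectralCharacteristic (F : Measure ℝ) (Z : Set ℝ → Lp ℂ 2 P) (n : ℕ) (μ : ℤ)
    (g : ℝ → ℂ) (X : Lp ℂ 2 P) : Prop :=
  HasStochIntegral F Z (fun x => g x * incrKernel n μ x) X

end Spaces

/-! ### The Hankel operator and the formula for the spectral characteristic -/

/-- Lebesgue measure on `[-π, π)`. -/
abbrev lebPi : Measure ℝ := volume.restrict (Set.Ico (-Real.pi) Real.pi)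

theorem memLp_exp (j : ℤ) :
    MemLp (fun x : ℝ => Complex.exp (Complex.I * j * x)) 2 lebPi := by
  refine MemLp.of_bound (C := 1) (by fun_prop) (Eventually.of_forall fun x => ?_)
  have e : Complex.I * j * x = ((j * x : ℝ) : ℂ) * Complex.I := by push_cast; ring
  rw [e, Complex.norm_exp_ofReal_mul_I]

/-- The exponential `e^{ijx}` as an element of `L₂(-π, π)`. -/
def expLp (j : ℤ) : Lp ℂ 2 lebPi := (memLp_exp j).toLp _

/-- The sum `∑_{k ≥ 0} c(k) e^{isxk}` in `L₂(-π, π)`, for a square summable `c`. With `s = 1` it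
is the function `C(e^{ix})`, with `s = -1` the function `C(e^{-ix})`, where
`C(z) = ∑ c(k) z^k`. -/
def expSeries (s : ℤ) (c : ℕ → ℂ) : Lp ℂ 2 lebPi := ∑' k : ℕ, c k • expLp (s * k)

/-- `T` is the operator on `ℓ₂` with matrix elements `b(k + j)`, `k, j ≥ 0`. -/
def IsHankelOperator (b : ℕ → ℂ) (T : EllTwo →L[ℂ] EllTwo) : Prop :=
  ∀ (x : EllTwo) (k : ℕ), HasSum (fun j : ℕ => b (k + j) * x j) (T x k)

/-- The function `B(e^{ix}) - r(e^{ix}) Φ_μ(e^{-ix})⁻¹`, where `B(z) = ∑ b(k) z^k`,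
`Φ_μ(z) = ∑ φ_μ(k) z^k` and `r(z) = ∑ (T φ_μ)_j z^j`. -/
def optimalCharacteristic (b : ℕ → ℂ) (T : EllTwo →L[ℂ] EllTwo) (φμ : EllTwo) : ℝ → ℂ := fun x =>
  expSeries 1 b x - expSeries 1 (T φμ) x * (expSeries (-1) φμ x)⁻¹

end StatIncr

end

open StatIncr

/-! The canonical factorization bounds the density between two positive constants (off a null set),
so L₂(F) and L₂(-π, π) have equivalent norms and the same null sets. With K_μ = `incrKernel n μ`,
the increments have the same Gram matrix as the functions e^{imx} K_μ(x), so an isometry V from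
L₂(F) carries these functions to the increments (`exists_spectralIsometry`). It turns multiplication
by e^{ijx} into the time shift, and the stochastic integral of every spectral representation is V
(`IsSpectralRepresentation.hasStochIntegral_iff`).

Canonical representations come from a Wold decomposition (`exists_innovation`). The remote past is
trivial because the functions e^{imx} K_1 have a total biorthogonal family; it is square integrable
since K_1 ρ is bounded away from zero. All steps generate the same past
(`HasBoundedDensity.specPast_eq`): K_μ is K_1 times the n-th power of a window sum of exponentials,
and these factors can be cancelled with the help of the Riemann–Lebesgue lemma. Hence the estimate
from one step is also optimal for all steps.

In an arbitrary canonical representation, ε(m) = V(e^{imx} v) for a single v, and |v|² ρ = 1/(2π).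
The moving average then reads K_μ = v Φ_μ, so Φ_μ ≠ 0 almost everywhere. The error of the projection
onto the past is the sum of (B^μ φ_μ)_j ε(j) over j ≥ 0 (`IsCanonicalRepresentation.eq_residual`),
with spectral image r_μ v = r_μ Φ_μ⁻¹ K_μ. Subtracting it from B^μ(e^{ix}) K_μ leaves h_μ K_μ;
division by K_μ, which is nonzero almost everywhere, gives uniqueness. -/

namespace StatIncr

/-! ### Closed spans, isometries and the Wold decomposition in Hilbert space. -/

section Hilbert

variable {E G : Type*} [NormedAddCommGroup E] [InnerProductSpace ℂ E]
  [NormedAddCommGroup G] [InnerProductSpace ℂ G]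

/-- The closed linear span of a set of vectors. -/
abbrev closedSpan (s : Set E) : Submodule ℂ E := (Submodule.span ℂ s).topologicalClosure

theorem subset_closedSpan {s : Set E} {x : E} (hx : x ∈ s) : x ∈ closedSpan s :=
  Submodule.le_topologicalClosure _ (Submodule.subset_span hx)

theorem closedSpan_le {s : Set E} {K : Submodule ℂ E} (hK : IsClosed (K : Set E))
    (h : ∀ x ∈ s, x ∈ K) : closedSpan s ≤ K :=
  Submodule.topologicalClosure_minimal _ (Submodule.span_le.2 h) hK

theorem isClosed_closedSpan (s : Set E) : IsClosed (closedSpan s : Set E) :=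
  Submodule.isClosed_topologicalClosure _

theorem closedSpan_mono {s t : Set E} (h : s ⊆ t) : closedSpan s ≤ closedSpan t :=
  closedSpan_le (isClosed_closedSpan t) fun _ hx => subset_closedSpan (h hx)

theorem eqOn_closedSpan {A B : E →L[ℂ] G} {s : Set E} (h : ∀ x ∈ s, A x = B x) {x : E}
    (hx : x ∈ closedSpan s) : A x = B x := by
  have : closedSpan s ≤ LinearMap.ker (A - B).toLinearMap := by
    refine closedSpan_le (ContinuousLinearMap.isClosed_ker (A - B)) fun y hy => ?_
    simp [h y hy]
  simpa [sub_eq_zero] using this hx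

theorem inner_eq_zero_of_mem_closedSpan {s : Set E} {y : E} (h : ∀ z ∈ s, inner ℂ z y = 0) {x : E}
    (hx : x ∈ closedSpan s) : inner ℂ x y = 0 := by
  have := eqOn_closedSpan (A := innerSL ℂ y) (B := 0)
    (fun z hz => by simpa using inner_eq_zero_symm.1 (h z hz)) hx
  exact inner_eq_zero_symm.1 (by simpa using this)

theorem mem_closedSpan_of_orthogonal [CompleteSpace E] {s : Set E} {x : E}
    (h : ∀ y, (∀ z ∈ s, inner ℂ z y = 0) → inner ℂ x y = 0) : x ∈ closedSpan s := by
  rw [closedSpan, ← Submodule.orthogonal_orthogonal_eq_closure, Submodule.mem_orthogonal']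
  exact fun y hy => h y fun z hz =>
    (Submodule.mem_orthogonal _ _).1 hy z (Submodule.subset_span hz)

/-- An isometry with complete domain is a closed embedding, so it commutes with closures. -/
theorem map_closedSpan [CompleteSpace E] (V : E →ₗᵢ[ℂ] G) (s : Set E) :
    (closedSpan s).map V.toLinearMap = closedSpan (V '' s) := by
  apply SetLike.coe_injective
  have h1 : (Submodule.map V.toLinearMap (closedSpan s) : Set G) =
      V '' closure (Submodule.span ℂ s : Set E) := rfl
  have h2 : ((closedSpan (V '' s) : Submodule ℂ G) : Set G) =
      closure (Submodule.span ℂ (V '' s) : Set G) := rfl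
  rw [h1, h2, ← V.isometry.isClosedEmbedding.closure_image_eq]
  congr 1
  have := Submodule.map_span V.toLinearMap s
  exact congrArg (fun K : Submodule ℂ G => (K : Set G)) this

/-- Two families of vectors with the same Gram matrix are related by a linear isometry. -/
theorem exists_linearIsometry_of_inner_eq [CompleteSpace G] {ι : Type*} {a : ι → E}
    {b : ι → G} (hd : closedSpan (Set.range a) = ⊤)
    (h : ∀ i j, inner ℂ (a i) (a j) = inner ℂ (b i) (b j)) :
    ∃ V : E →ₗᵢ[ℂ] G, ∀ i, V (a i) = b i := by
  let e := Finsupp.linearCombination ℂ a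
  let g := Finsupp.linearCombination ℂ b
  have hn : ∀ c, ‖g c‖ = ‖e c‖ := by
    intro c
    have : inner ℂ (g c) (g c) = inner ℂ (e c) (e c) := by
      simp only [g, e, Finsupp.linearCombination_apply, Finsupp.sum, sum_inner, inner_sum,
        inner_smul_left, inner_smul_right, h]
    rw [inner_self_eq_norm_sq_to_K, inner_self_eq_norm_sq_to_K] at this
    have h3 : ‖g c‖ ^ 2 = ‖e c‖ ^ 2 := by exact_mod_cast this
    exact (pow_left_inj₀ (norm_nonneg _) (norm_nonneg _) two_ne_zero).1 h3
  have hdense : DenseRange e := by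
    have : Dense (Submodule.span ℂ (Set.range a) : Set E) :=
      Submodule.dense_iff_topologicalClosure_eq_top.2 hd
    rwa [← Finsupp.range_linearCombination] at this
  -- `e` need not be injective; the norm bound is what makes `g` factor through its dense range.
  have hle : ∃ C, ∀ x, ‖g x‖ ≤ C * ‖e x‖ := ⟨1, fun x => by rw [hn, one_mul]⟩
  have hex := fun x => LinearMap.extendOfNorm_eq hdense hle x
  refine ⟨⟨(g.extendOfNorm e).toLinearMap, fun x => ?_⟩, fun i => ?_⟩
  · have : IsClosed {x | ‖g.extendOfNorm e x‖ = ‖x‖} :=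
      isClosed_eq (by fun_prop) (by fun_prop)
    exact hdense.induction (fun y ⟨c, hc⟩ => by
      rw [← hc]; change ‖g.extendOfNorm e (e c)‖ = _; rw [hex, hn]) this x
  · have := hex (Finsupp.single i 1)
    simpa [e, g, Finsupp.linearCombination_single] using this

/-- Square summable combinations of an orthonormal sequence. -/
theorem _root_.Orthonormal.exists_linearIsometry_ellTwo [CompleteSpace G] {u : ℕ → G}
    (hu : Orthonormal ℂ u) :
    ∃ W : EllTwo →ₗᵢ[ℂ] G, (∀ c : EllTwo, HasSum (fun k => c k • u k) (W c)) ∧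
      ∀ x, x ∈ closedSpan (Set.range u) → ∃ c, W c = x := by
  have hs := fun c : EllTwo => hu.orthogonalFamily.hasSum_linearIsometry c
  simp only [LinearIsometry.toSpanSingleton_apply] at hs
  refine ⟨hu.orthogonalFamily.linearIsometry, hs, fun x hx => ?_⟩
  have hr := hu.orthogonalFamily.range_linearIsometry
  have : closedSpan (Set.range u) ≤ LinearMap.range hu.orthogonalFamily.linearIsometry.toLinearMap := by
    rw [hr]
    refine Submodule.topologicalClosure_mono (Submodule.span_le.2 ?_)
    rintro _ ⟨k, rfl⟩
    refine Submodule.mem_iSup_of_mem k ⟨1, by simp⟩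
  exact this hx

/-- **Wold decomposition** of a stationary sequence `S m a` with a total biorthogonal sequence
`d`: its past spaces are spanned by an orthonormal sequence `S m v`. -/
theorem exists_innovation [CompleteSpace E] (S : ℤ → E →ₗᵢ[ℂ] E)
    (hS : ∀ i j x, S i (S j x) = S (i + j) x) (hS0 : ∀ x, S 0 x = x) (a : E) (d : ℤ → E)
    (hd : ∀ j m, j ≠ m → inner ℂ (d j) (S m a) = 0) (hd0 : inner ℂ (d 0) a ≠ 0)
    (htot : ∀ g, (∀ j, inner ℂ (d j) g = 0) → g = 0) :
    ∃ v : E, Orthonormal ℂ (fun m => S m v) ∧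
      ∀ t : ℤ, closedSpan {x | ∃ m : ℤ, m ≤ t ∧ x = S m a} =
        closedSpan {x | ∃ m : ℤ, m ≤ t ∧ x = S m v} := by
  set M : ℤ → Submodule ℂ E := fun t => closedSpan {x | ∃ m : ℤ, m ≤ t ∧ x = S m a} with hM
  have hcl : ∀ t, IsClosed (M t : Set E) := fun t => isClosed_closedSpan _
  have hmem : ∀ {m t : ℤ}, m ≤ t → S m a ∈ M t := fun h => subset_closedSpan ⟨_, h, rfl⟩
  have hmono : ∀ {s t : ℤ}, s ≤ t → M s ≤ M t := fun h =>
    closedSpan_mono fun x ⟨m, hm, hx⟩ => ⟨m, hm.trans h, hx⟩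
  have hshift : ∀ (j t : ℤ) (x : E), x ∈ M t → S j x ∈ M (t + j) := by
    intro j t x hx
    have : M t ≤ (M (t + j)).comap (S j).toLinearMap := by
      refine closedSpan_le ((hcl _).preimage (S j).continuous) ?_
      rintro _ ⟨m, hm, rfl⟩
      change S j (S m a) ∈ M (t + j)
      rw [hS]
      exact hmem (by omega)
    exact this hx
  have hMd : ∀ {j t : ℤ} {x : E}, t < j → x ∈ M t → inner ℂ (d j) x = 0 := by
    intro j t x hj hx
    refine inner_eq_zero_symm.1 (inner_eq_zero_of_mem_closedSpan ?_ hx)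
    rintro _ ⟨m, hm, rfl⟩
    exact inner_eq_zero_symm.1 (hd _ _ (by omega))
  have : CompleteSpace (M (-1)) := (hcl (-1)).completeSpace_coe
  -- The innovation at time 0 is the normalized part of `a` orthogonal to its strict past. It is
  -- nonzero because `d 0` annihilates that past but not `a`.
  set p : E := (M (-1)).starProjection a with hp
  have hpM : p ∈ M (-1) := Submodule.starProjection_apply_mem _ _
  have hap : a - p ≠ 0 := by
    intro h0
    apply hd0
    rw [sub_eq_zero.1 h0]
    exact hMd (by omega) hpM
  have hnorm : (‖a - p‖ : ℂ) ≠ 0 := by exact_mod_cast norm_ne_zero_iff.2 hap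
  set v : E := ((‖a - p‖ : ℂ)⁻¹) • (a - p) with hv
  have hav : a = p + (‖a - p‖ : ℂ) • v := by
    rw [hv, smul_inv_smul₀ hnorm]; abel
  have hvn : ‖v‖ = 1 := by
    rw [hv, norm_smul, norm_inv, Complex.norm_real, norm_norm]
    exact inv_mul_cancel₀ (norm_ne_zero_iff.2 hap)
  have hvorth : ∀ x ∈ M (-1), inner ℂ x v = 0 := by
    intro x hx
    rw [hv, inner_smul_right]
    have := Submodule.sub_starProjection_mem_orthogonal (K := M (-1)) a
    rw [(Submodule.mem_orthogonal _ _).1 this x hx, mul_zero]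
  have hvorth' : ∀ (m : ℤ) (x : E), x ∈ M (m - 1) → inner ℂ x (S m v) = 0 := by
    intro m x hx
    have h1 : x = S m (S (-m) x) := by rw [hS, add_neg_cancel, hS0]
    rw [h1, (S m).inner_map_map]
    refine hvorth _ ?_
    have := hshift (-m) _ _ hx
    rwa [show m - 1 + -m = -1 by ring] at this
  have ha0 : a ∈ M 0 := by simpa [hS0] using hmem (le_refl (0 : ℤ))
  have hvM0 : v ∈ M 0 := by
    refine Submodule.smul_mem _ _ (Submodule.sub_mem _ ha0 (hmono (by omega) hpM))
  have hvM : ∀ m, S m v ∈ M m := fun m => by simpa using hshift m 0 v hvM0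
  have horth : Orthonormal ℂ (fun m => S m v) := by
    refine ⟨fun m => by rw [(S m).norm_map, hvn], ?_⟩
    intro i j hij
    rcases lt_or_gt_of_ne hij with h | h
    · exact hvorth' j _ (hmono (by omega) (hvM i))
    · exact inner_eq_zero_symm.1 (hvorth' i _ (hmono (by omega) (hvM j)))
  refine ⟨v, horth, fun t => le_antisymm ?_ ?_⟩
  swap
  · refine closedSpan_le (hcl t) ?_
    rintro _ ⟨m, hm, rfl⟩
    exact hmono hm (hvM m)
  -- On generators of `M s`, the identity is the projection onto `M (s - 1)` plus the component
  -- along `S s v`. By continuity this holds on `M s`, so an element without that component lies one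
  -- step further back.
  have hstep : ∀ (s : ℤ) (g : E), g ∈ M s → inner ℂ (S s v) g = 0 → g ∈ M (s - 1) := by
    intro s g hg h0
    have : CompleteSpace (M (s - 1)) := (hcl (s - 1)).completeSpace_coe
    have key := eqOn_closedSpan (A := ContinuousLinearMap.id ℂ E)
      (B := (M (s - 1)).starProjection + (innerSL ℂ (S s v)).smulRight (S s v)) ?_ hg
    · simp only [ContinuousLinearMap.id_apply, add_apply,
        ContinuousLinearMap.smulRight_apply, innerSL_apply_apply, h0, zero_smul, add_zero] at key
      rw [key]
      exact Submodule.starProjection_apply_mem _ _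
    · rintro _ ⟨m, hm, rfl⟩
      simp only [ContinuousLinearMap.id_apply, add_apply,
        ContinuousLinearMap.smulRight_apply, innerSL_apply_apply]
      rcases hm.lt_or_eq with h | rfl
      · have hin : S m a ∈ M (s - 1) := hmem (by omega)
        rw [Submodule.starProjection_eq_self_iff.2 hin,
          inner_eq_zero_symm.1 (hvorth' s _ hin), zero_smul, add_zero]
      · have hSp : S m p ∈ M (m - 1) := by
          have := hshift m _ _ hpM
          rwa [show -1 + m = m - 1 by ring] at this
        have hdec : S m a = S m p + (‖a - p‖ : ℂ) • S m v := by
          conv_lhs => rw [hav]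
          rw [map_add, map_smul]
        have hv0 : (M (m - 1)).starProjection (S m v) = 0 :=
          (Submodule.starProjection_apply_eq_zero_iff _).2
            ((Submodule.mem_orthogonal _ _).2 (hvorth' m))
        have hvv : inner ℂ (S m v) (S m v) = (1 : ℂ) := by
          rw [inner_self_eq_norm_sq_to_K, horth.1 m]; simp
        conv_rhs => rw [hdec]
        rw [map_add, map_smul, hv0, Submodule.starProjection_eq_self_iff.2 hSp, inner_add_right,
          inner_eq_zero_symm.1 (hvorth' m _ hSp), inner_smul_right, hvv]
        simpa using hdec
  intro x hx
  set N := closedSpan {x | ∃ m : ℤ, m ≤ t ∧ x = S m v} with hN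
  have hNM : N ≤ M t := by
    refine closedSpan_le (hcl t) ?_
    rintro _ ⟨m, hm, rfl⟩
    exact hmono hm (hvM m)
  have : CompleteSpace N := (isClosed_closedSpan _).completeSpace_coe
  set g := x - N.starProjection x with hg
  have hgM : g ∈ M t := Submodule.sub_mem _ hx (hNM (Submodule.starProjection_apply_mem _ _))
  have hgv : ∀ m ≤ t, inner ℂ (S m v) g = 0 := fun m hm =>
    (Submodule.mem_orthogonal _ _).1 (Submodule.sub_starProjection_mem_orthogonal (K := N) x) _
      (subset_closedSpan ⟨m, hm, rfl⟩)
  -- What the innovations up to `t` leave over sinks through every past. As `d j` annihilates every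
  -- past ending before `j`, totality makes it zero.
  have hall : ∀ k : ℕ, g ∈ M (t - k) := by
    intro k
    induction k with
    | zero => simpa using hgM
    | succ k ih =>
      have := hstep _ _ ih (hgv _ (by omega))
      rwa [show t - (k : ℤ) - 1 = t - ((k + 1 : ℕ) : ℤ) by push_cast; ring] at this
  have hg0 : g = 0 := by
    refine htot g fun j => hMd (t := t - ((t - j).toNat + 1 : ℕ)) ?_ (hall _)
    have := Int.self_le_toNat (t - j)
    push_cast
    omega
  rw [sub_eq_zero.1 hg0]
  exact Submodule.starProjection_apply_mem _ _

end Hilbert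

/-! ### Uniqueness of Fourier coefficients on [-π, π). -/

section Fourier

theorem norm_exp_I_mul_int (j : ℤ) (x : ℝ) : ‖Complex.exp (Complex.I * j * x)‖ = 1 := by
  have e : Complex.I * j * x = ((j * x : ℝ) : ℂ) * Complex.I := by push_cast; ring
  rw [e, Complex.norm_exp_ofReal_mul_I]

theorem exp_I_mul_add (i j : ℤ) (x : ℝ) :
    Complex.exp (Complex.I * i * x) * Complex.exp (Complex.I * j * x) =
      Complex.exp (Complex.I * (i + j : ℤ) * x) := by
  rw [← Complex.exp_add]; push_cast; congr 1; ring

theorem conj_exp_I_mul (j : ℤ) (x : ℝ) :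
    conj (Complex.exp (Complex.I * j * x)) = Complex.exp (Complex.I * (-j : ℤ) * x) := by
  rw [← Complex.exp_conj]; simp

theorem measurable_exp_I_mul (j : ℤ) :
    Measurable fun x : ℝ => Complex.exp (Complex.I * j * x) := by fun_prop

instance : IsFiniteMeasure lebPi := ⟨by simp⟩

theorem integral_exp_lebPi (j : ℤ) :
    ∫ x, Complex.exp (Complex.I * j * x) ∂lebPi = if j = 0 then (2 * Real.pi : ℂ) else 0 := by
  rw [integral_Ico_eq_integral_Ioc, ← intervalIntegral.integral_of_le (by linarith [Real.pi_pos])]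
  split_ifs with h
  · subst h; simp; ring
  · have hc : Complex.I * j ≠ 0 := by simp [h]
    rw [integral_exp_mul_complex hc, div_eq_zero_iff]
    left
    rw [sub_eq_zero, Complex.exp_eq_exp_iff_exists_int]
    exact ⟨j, by push_cast; ring⟩

/-- Integration against `g` is a continuous functional in the sup norm, and trigonometric
polynomials are dense in the continuous functions on the circle. -/
theorem integral_continuousMap_mul_eq_zero {g : ℝ → ℂ} (hg : Integrable g lebPi)
    (h : ∀ j : ℤ, ∫ x, Complex.exp (Complex.I * j * x) * g x ∂lebPi = 0)
    (H : C(AddCircle (2 * Real.pi), ℂ)) : ∫ x : ℝ, H (x : AddCircle (2 * Real.pi)) * g x ∂lebPi = 0 := by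
  have : Fact (0 < 2 * Real.pi) := ⟨Real.two_pi_pos⟩
  have hcont : ∀ K : C(AddCircle (2 * Real.pi), ℂ),
      Continuous fun x : ℝ => K (x : AddCircle (2 * Real.pi)) :=
    fun K => K.continuous.comp (AddCircle.continuous_mk' _)
  have hint : ∀ K : C(AddCircle (2 * Real.pi), ℂ),
      Integrable (fun x : ℝ => K (x : AddCircle (2 * Real.pi)) * g x) lebPi := fun K =>
    hg.bdd_mul (hcont K).aestronglyMeasurable (c := ‖K‖)
      (Eventually.of_forall fun x => K.norm_coe_le_norm _)
  let L : C(AddCircle (2 * Real.pi), ℂ) →L[ℂ] ℂ := LinearMap.mkContinuous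
    { toFun := fun K => ∫ x : ℝ, K (x : AddCircle (2 * Real.pi)) * g x ∂lebPi
      map_add' := fun K K' => by
        rw [← integral_add (hint K) (hint K')]; simp [add_mul]
      map_smul' := fun c K => by
        rw [RingHom.id_apply, ← integral_smul]; simp [mul_assoc] }
    (∫ x, ‖g x‖ ∂lebPi) fun K => by
      change ‖∫ x : ℝ, K (x : AddCircle (2 * Real.pi)) * g x ∂lebPi‖ ≤ _
      rw [mul_comm (∫ x, ‖g x‖ ∂lebPi), ← integral_const_mul]
      refine norm_integral_le_of_norm_le (hg.norm.const_mul _) (Eventually.of_forall fun x => ?_)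
      rw [norm_mul]
      gcongr
      exact K.norm_coe_le_norm _
  have hle : (Submodule.span ℂ (Set.range <| @fourier (2 * Real.pi))).topologicalClosure ≤
      LinearMap.ker L.toLinearMap := by
    refine Submodule.topologicalClosure_minimal _ (Submodule.span_le.2 ?_)
      (ContinuousLinearMap.isClosed_ker L)
    rintro _ ⟨j, rfl⟩
    change ∫ x : ℝ, fourier j (x : AddCircle (2 * Real.pi)) * g x ∂lebPi = 0
    rw [← h j]
    congr 1
    ext x
    rw [fourier_coe_apply]
    congr 2
    have := Real.pi_pos.ne'
    push_cast
    field_simp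
  rw [span_fourier_closure_eq_top] at hle
  exact hle (Submodule.mem_top (x := H))

/-- An integrable function on `[-π, π)` all of whose Fourier coefficients vanish is zero. -/
theorem ae_eq_zero_of_integral_exp_eq_zero {g : ℝ → ℂ} (hg : Integrable g lebPi)
    (h : ∀ j : ℤ, ∫ x, Complex.exp (Complex.I * j * x) * g x ∂lebPi = 0) : g =ᵐ[lebPi] 0 := by
  have : Fact (0 < 2 * Real.pi) := ⟨Real.two_pi_pos⟩
  have hU : IsOpen (Set.Ioo (-Real.pi) Real.pi) := isOpen_Ioo
  have hsub : Set.Ioo (-Real.pi) Real.pi ⊆ Set.Ico (-Real.pi) Real.pi := Set.Ioo_subset_Ico_self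
  have key := hU.ae_eq_zero_of_integral_contDiff_smul_eq_zero (μ := volume) (f := g)
    (IntegrableOn.locallyIntegrableOn (IntegrableOn.mono_set hg hsub)) ?_
  · rw [EventuallyEq, ae_restrict_iff' measurableSet_Ico]
    have h0 : ∀ᵐ x : ℝ, x ≠ -Real.pi := by simp [ae_iff]
    filter_upwards [key, h0] with x hx hx0 hm
    exact hx ⟨lt_of_le_of_ne hm.1 (Ne.symm hx0), hm.2⟩
  · intro u hu _ hsupp
    have hz : ∀ x, x ∉ Set.Ioo (-Real.pi) Real.pi → u x = 0 := fun x hx =>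
      image_eq_zero_of_notMem_tsupport fun hx' => hx (hsupp hx')
    -- A test function supported in the open interval vanishes at both endpoints, hence descends to
    -- a continuous function on the circle.
    have hend : (fun x => (u x : ℂ)) (-Real.pi) = (fun x => (u x : ℂ)) (-Real.pi + 2 * Real.pi) := by
      change (u _ : ℂ) = u _
      rw [hz _ (by simp), hz _ (by simp only [Set.mem_Ioo, not_and, not_lt]; intro; linarith)]
    let H : C(AddCircle (2 * Real.pi), ℂ) := ⟨AddCircle.liftIco (2 * Real.pi) (-Real.pi)
      (fun x => (u x : ℂ)), AddCircle.liftIco_continuous hend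
        (Complex.continuous_ofReal.comp hu.continuous).continuousOn⟩
    have h1 := integral_continuousMap_mul_eq_zero hg h H
    have h2 : ∫ x, u x • g x = ∫ x in Set.Ico (-Real.pi) Real.pi, u x • g x := by
      rw [setIntegral_eq_integral_of_forall_compl_eq_zero]
      intro x hx
      rw [hz x fun hx' => hx (hsub hx'), zero_smul]
    rw [h2, ← h1]
    refine setIntegral_congr_fun measurableSet_Ico fun x hx => ?_
    have : H (x : AddCircle (2 * Real.pi)) = u x :=
      AddCircle.liftIco_coe_apply (f := fun x => (u x : ℂ))
        (by rwa [show -Real.pi + 2 * Real.pi = Real.pi by ring])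
    simp [this]

end Fourier

/-! ### Multiplication operators and inner products in L₂. -/

section Multiplication

/-- Multiplication by a bounded function, as an operator between the `L₂` spaces of two measures
one of which dominates the other. -/
theorem exists_mul_clm {α : Type*} [MeasurableSpace α] {lam ν : Measure α} {C : ℝ≥0∞} (hC : C ≠ ∞)
    (hν : ν ≤ C • lam) {w : α → ℂ} (hw : AEStronglyMeasurable w ν) {K : ℝ}
    (hK : ∀ᵐ x ∂ν, ‖w x‖ ≤ K) :
    ∃ A : Lp ℂ 2 lam →L[ℂ] Lp ℂ 2 ν, ∀ g : Lp ℂ 2 lam, A g =ᵐ[ν] fun x => w x * g x := by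
  have hac : ν ≪ lam := (Measure.absolutelyContinuous_of_le hν).trans Measure.smul_absolutelyContinuous
  have hmem : ∀ {g : α → ℂ}, MemLp g 2 lam → MemLp (fun x => w x * g x) 2 ν := fun hg =>
    (hg.of_measure_le_smul hC hν).of_le_mul (c := K)
      (hw.mul (hg.1.mono_ac hac)) (by
        filter_upwards [hK] with x hx
        rw [norm_mul]; gcongr)
  have hbd : ∀ g : α → ℂ, eLpNorm (fun x => w x * g x) 2 ν ≤
      ENNReal.ofReal K * (C ^ (1 / (2 : ℝ≥0∞).toReal) * eLpNorm g 2 lam) := fun g => by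
    refine (eLpNorm_le_mul_eLpNorm_of_ae_le_mul (c := K) (g := g) ?_ 2).trans ?_
    · filter_upwards [hK] with x hx
      rw [norm_mul]; gcongr
    · gcongr
      refine (eLpNorm_mono_measure g hν).trans ?_
      rw [eLpNorm_smul_measure_of_ne_top (by simp), smul_eq_mul]
      simp
  let T : Lp ℂ 2 lam →ₗ[ℂ] Lp ℂ 2 ν :=
    { toFun := fun g => (hmem (Lp.memLp g)).toLp _
      map_add' := fun g g' => by
        rw [← MemLp.toLp_add]
        refine MemLp.toLp_congr _ _ ?_
        filter_upwards [hac.ae_eq (Lp.coeFn_add g g')] with x hx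
        rw [hx, Pi.add_apply, Pi.add_apply, mul_add]
      map_smul' := fun c g => by
        rw [RingHom.id_apply, ← MemLp.toLp_const_smul]
        refine MemLp.toLp_congr _ _ ?_
        filter_upwards [hac.ae_eq (Lp.coeFn_smul c g)] with x hx
        rw [hx, Pi.smul_apply, Pi.smul_apply, smul_eq_mul, smul_eq_mul]; ring }
  refine ⟨T.mkContinuous (ENNReal.ofReal K * C ^ (1 / (2 : ℝ≥0∞).toReal)).toReal fun g => ?_,
    fun g => (hmem (Lp.memLp g)).coeFn_toLp⟩
  change ‖(hmem (Lp.memLp g)).toLp _‖ ≤ _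
  rw [Lp.norm_toLp, Lp.norm_def, ← ENNReal.toReal_mul, mul_assoc]
  refine ENNReal.toReal_mono ?_ (hbd g)
  exact ENNReal.mul_ne_top ENNReal.ofReal_ne_top (ENNReal.mul_ne_top
    (ENNReal.rpow_ne_top_of_nonneg (by positivity) hC) (Lp.eLpNorm_ne_top g))

theorem inner_eq_integral {α : Type*} [MeasurableSpace α] {ν : Measure α} {f g : Lp ℂ 2 ν}
    {f' g' : α → ℂ} (hf : f =ᵐ[ν] f') (hg : g =ᵐ[ν] g') :
    inner ℂ f g = ∫ x, g' x * conj (f' x) ∂ν := by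
  rw [L2.inner_def]
  refine integral_congr_ae ?_
  filter_upwards [hf, hg] with x h1 h2
  rw [h1, h2]; simp

end Multiplication

/-! ### One-sided exponential series in L₂(-π, π). -/

section ExpSeries

theorem coeFn_expLp (j : ℤ) : expLp j =ᵐ[lebPi] fun x => Complex.exp (Complex.I * j * x) :=
  MemLp.coeFn_toLp _

theorem inner_expLp (i j : ℤ) :
    inner ℂ (expLp i) (expLp j) = if i = j then (2 * Real.pi : ℂ) else 0 := by
  rw [inner_eq_integral (coeFn_expLp i) (coeFn_expLp j)]
  simp_rw [conj_exp_I_mul, exp_I_mul_add, integral_exp_lebPi]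
  have : j + -i = 0 ↔ i = j := by omega
  simp only [this]

theorem norm_expLp (j : ℤ) : ‖expLp j‖ = √(2 * Real.pi) := by
  rw [@norm_eq_sqrt_re_inner ℂ, inner_expLp, if_pos rfl]
  congr 1
  simp

theorem orthonormal_expLp {s : ℤ} (hs : s ≠ 0) :
    Orthonormal ℂ fun k : ℕ => ((√(2 * Real.pi) : ℝ) : ℂ)⁻¹ • expLp (s * k) := by
  have h0 : √(2 * Real.pi) ≠ 0 := by positivity
  refine ⟨fun k => ?_, fun i j hij => ?_⟩
  · rw [norm_smul, norm_expLp, norm_inv, Complex.norm_real, Real.norm_of_nonneg (by positivity)]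
    exact inv_mul_cancel₀ h0
  · change inner ℂ (_ • expLp _) (_ • expLp _) = 0
    rw [inner_smul_left, inner_smul_right, inner_expLp, if_neg]
    · simp
    · simp [hs, hij]

theorem hasSum_expSeries {s : ℤ} (hs : s ≠ 0) (c : EllTwo) :
    HasSum (fun k : ℕ => c k • expLp (s * k)) (expSeries s c) ∧
      ‖expSeries s c‖ = √(2 * Real.pi) * ‖c‖ := by
  obtain ⟨W, hW, -⟩ := (orthonormal_expLp hs).exists_linearIsometry_ellTwo
  have h0 : ((√(2 * Real.pi) : ℝ) : ℂ) ≠ 0 := by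
    have : √(2 * Real.pi) ≠ 0 := by positivity
    exact_mod_cast this
  have h1 := (hW c).const_smul ((√(2 * Real.pi) : ℝ) : ℂ)
  have h2 : (fun k : ℕ => ((√(2 * Real.pi) : ℝ) : ℂ) •
      (c k • ((√(2 * Real.pi) : ℝ) : ℂ)⁻¹ • expLp (s * k))) = fun k : ℕ => c k • expLp (s * k) := by
    ext1 k
    rw [smul_comm (c k), smul_inv_smul₀ h0]
  rw [h2] at h1
  have h3 : expSeries s c = ((√(2 * Real.pi) : ℝ) : ℂ) • W c := h1.tsum_eq
  rw [h3]
  refine ⟨h1, ?_⟩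
  rw [norm_smul, W.norm_map, Complex.norm_real, Real.norm_of_nonneg (by positivity)]

theorem hasSum_expSeries_of_summable (s : ℤ) {c : ℕ → ℂ} (hc : Summable fun k => ‖c k‖) :
    HasSum (fun k : ℕ => c k • expLp (s * k)) (expSeries s c) := by
  refine Summable.hasSum (Summable.of_norm ?_)
  simp_rw [norm_smul, norm_expLp]
  exact hc.mul_right _

theorem norm_sq_eq_integral {α : Type*} [MeasurableSpace α] {ν : Measure α} (f : Lp ℂ 2 ν) :
    ‖f‖ ^ 2 = ∫ x, ‖f x‖ ^ 2 ∂ν := by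
  have h := inner_eq_integral (EventuallyEq.refl _ f) (EventuallyEq.refl _ f)
  rw [inner_self_eq_norm_sq_to_K] at h
  have : ∀ x, f x * conj (f x) = ((‖f x‖ ^ 2 : ℝ) : ℂ) := fun x => by
    rw [Complex.mul_conj, Complex.normSq_eq_norm_sq]
  simp_rw [this] at h
  rw [integral_complex_ofReal] at h
  exact Complex.ofReal_injective (by rw [← h]; simp)

theorem integral_norm_sq_expSeries {s : ℤ} (hs : s ≠ 0) (c : EllTwo) :
    (2 * Real.pi)⁻¹ * ∫ x, ‖expSeries s c x‖ ^ 2 ∂lebPi = ‖c‖ ^ 2 := by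
  rw [← norm_sq_eq_integral, (hasSum_expSeries hs c).2, mul_pow, Real.sq_sqrt (by positivity),
    inv_mul_cancel_left₀ (by positivity)]

end ExpSeries

/-! ### Measures with density bounded above and below. -/

section Density

/-- `F` has a measurable density `ρ` with `c ≤ ρ ≤ C` and `c > 0` with respect to Lebesgue measure
on `[-π, π)`. -/
structure HasBoundedDensity (F : Measure ℝ) (ρ : ℝ → ℝ) (c C : ℝ) : Prop where
  eq_withDensity : F = lebPi.withDensity fun x => ENNReal.ofReal (ρ x)
  measurable : Measurable ρ
  pos : 0 < c
  lower : ∀ x, c ≤ ρ x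
  upper : ∀ x, ρ x ≤ C

/-- |Φ|² is continuous and nonvanishing on the compact unit circle, so its minimum and maximum there
serve as bounds. Using |Φ|² in place of `f` makes the bounds hold everywhere. -/
theorem IsCanonicalFactorization.exists_hasBoundedDensity {f : ℝ → ℝ} {φ : ℕ → ℂ}
    (h : IsCanonicalFactorization f φ) :
    ∃ ρ c C, HasBoundedDensity (densityMeasure f) ρ c C := by
  obtain ⟨⟨r, hr, hs⟩, hne, hae⟩ := h
  have hsum : Summable fun k => ‖φ k‖ := by
    refine hs.of_nonneg_of_le (fun k => norm_nonneg _) fun k => ?_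
    exact le_mul_of_one_le_right (norm_nonneg _) (one_le_pow₀ hr.le)
  have hcont : ContinuousOn (fun z : ℂ => ∑' k, φ k * z ^ k) (Metric.sphere 0 1) := by
    refine continuousOn_tsum (fun k => by fun_prop) hsum fun k z hz => ?_
    rw [norm_mul, norm_pow, mem_sphere_zero_iff_norm.1 hz, one_pow, mul_one]
  have hcomp : IsCompact (Metric.sphere (0 : ℂ) 1) := isCompact_sphere _ _
  have hnon : (Metric.sphere (0 : ℂ) 1).Nonempty := ⟨1, by simp⟩
  have hcont' := hcont.norm.pow 2
  obtain ⟨z₁, hz₁, h₁⟩ := hcomp.exists_isMinOn hnon hcont'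
  obtain ⟨z₂, hz₂, h₂⟩ := hcomp.exists_isMaxOn hnon hcont'
  have hmem : ∀ x : ℝ, Complex.exp (-(Complex.I * x)) ∈ Metric.sphere (0 : ℂ) 1 := fun x => by
    rw [mem_sphere_zero_iff_norm]
    have := norm_exp_I_mul_int (-1) x
    rwa [show Complex.I * (-1 : ℤ) * (x : ℂ) = -(Complex.I * x) by push_cast; ring] at this
  refine ⟨fun x => ‖∑' k, φ k * Complex.exp (-(Complex.I * x)) ^ k‖ ^ 2, _, _, ?_, ?_, ?_,
    fun x => h₁ (hmem x), fun x => h₂ (hmem x)⟩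
  · refine withDensity_congr_ae ?_
    filter_upwards [hae] with x hx
    rw [hx]
  · refine Continuous.measurable ?_
    exact hcont'.comp_continuous (by fun_prop) hmem
  · have := hne z₁ (mem_sphere_zero_iff_norm.1 hz₁).le
    exact pow_pos (norm_pos_iff.2 this) 2

namespace HasBoundedDensity

variable {F : Measure ℝ} {ρ : ℝ → ℝ} {c C : ℝ} (h : HasBoundedDensity F ρ c C)
include h

theorem ρ_pos (x : ℝ) : 0 < ρ x := h.pos.trans_le (h.lower x)

theorem le_smul : F ≤ ENNReal.ofReal C • lebPi := by
  rw [h.eq_withDensity, ← withDensity_const]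
  exact withDensity_mono (Eventually.of_forall fun x => ENNReal.ofReal_le_ofReal (h.upper x))

theorem isFiniteMeasure : IsFiniteMeasure F := by
  have h0 : IsFiniteMeasure (ENNReal.ofReal C • lebPi) :=
    Measure.smul_finite _ ENNReal.ofReal_ne_top
  exact isFiniteMeasure_of_le _ h.le_smul

theorem absolutelyContinuous : F ≪ lebPi := by
  rw [h.eq_withDensity]; exact withDensity_absolutelyContinuous _ _

theorem absolutelyContinuous' : lebPi ≪ F := by
  rw [h.eq_withDensity]
  refine withDensity_absolutelyContinuous' h.measurable.ennreal_ofReal.aemeasurable ?_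
  exact Eventually.of_forall fun x => (ENNReal.ofReal_pos.2 (h.ρ_pos x)).ne'

theorem integral_eq (g : ℝ → ℂ) : ∫ x, g x ∂F = ∫ x, (ρ x : ℂ) * g x ∂lebPi := by
  rw [h.eq_withDensity, integral_withDensity_eq_integral_toReal_smul
    h.measurable.ennreal_ofReal (Eventually.of_forall fun x => ENNReal.ofReal_lt_top)]
  refine integral_congr_ae (Eventually.of_forall fun x => ?_)
  simp [ENNReal.toReal_ofReal (h.ρ_pos x).le]

theorem integrable_iff {g : ℝ → ℂ} :
    Integrable g F ↔ Integrable (fun x => (ρ x : ℂ) * g x) lebPi := by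
  rw [h.eq_withDensity, integrable_withDensity_iff_integrable_smul'
    h.measurable.ennreal_ofReal (Eventually.of_forall fun x => ENNReal.ofReal_lt_top)]
  refine integrable_congr (Eventually.of_forall fun x => ?_)
  simp [ENNReal.toReal_ofReal (h.ρ_pos x).le]

theorem ae_eq_zero_of_integral_exp {g : ℝ → ℂ} (hg : Integrable g F)
    (h0 : ∀ j : ℤ, ∫ x, Complex.exp (Complex.I * j * x) * g x ∂F = 0) : g =ᵐ[F] 0 := by
  have := ae_eq_zero_of_integral_exp_eq_zero (h.integrable_iff.1 hg) fun j => by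
    rw [← h0 j, h.integral_eq]
    congr 1; ext x; ring
  filter_upwards [h.absolutelyContinuous.ae_le this] with x hx
  have h1 : (ρ x : ℂ) ≠ 0 := by exact_mod_cast (h.ρ_pos x).ne'
  simpa [h1] using hx

end HasBoundedDensity

end Density

/-! ### Bounds, zeros and factorization of the increment kernel. -/

section Kernel

variable (n : ℕ)

theorem measurable_incrKernel (μ : ℤ) : Measurable (incrKernel n μ) := by
  unfold incrKernel
  exact Measurable.ite (measurableSet_singleton 0) measurable_const (by fun_prop)

theorem norm_incrKernel_le (μ : ℤ) (x : ℝ) : ‖incrKernel n μ x‖ ≤ |(μ : ℝ)| ^ n := by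
  unfold incrKernel
  split_ifs with hx
  · simp
  · have hx' : 0 < |x| := abs_pos.2 hx
    rw [← div_pow, norm_pow]
    refine pow_le_pow_left₀ (norm_nonneg _) ?_ n
    rw [norm_div, norm_mul, Complex.norm_I, one_mul, Complex.norm_real, Real.norm_eq_abs,
      div_le_iff₀ hx', ← abs_mul, norm_sub_rev]
    have := Real.norm_exp_I_mul_ofReal_sub_one_le (x := -(μ * x))
    rw [Real.norm_eq_abs, abs_neg] at this
    rwa [show Complex.I * ((-(μ * x) : ℝ) : ℂ) = -(Complex.I * μ * x) by push_cast; ring] at this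

/-- |1 - e^{-ix}| = 2 |sin(x/2)|, and Jordan's inequality bounds the sine below. A larger step can
make the kernel vanish inside the interval, which is why the unit step serves as reference. -/
theorem le_norm_incrKernel_one {x : ℝ} (hx : |x| ≤ Real.pi) :
    (2 / Real.pi) ^ n ≤ ‖incrKernel n 1 x‖ := by
  have hpi := Real.pi_pos
  unfold incrKernel
  split_ifs with hx0
  · simp only [Int.cast_one, one_pow, norm_one]
    refine pow_le_one₀ (by positivity) ?_
    rw [div_le_one hpi]
    exact Real.two_le_pi
  · have hx' : 0 < |x| := abs_pos.2 hx0
    rw [← div_pow, norm_pow]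
    refine pow_le_pow_left₀ (by positivity) ?_ n
    rw [norm_div, norm_mul, Complex.norm_I, one_mul, Complex.norm_real, Real.norm_eq_abs,
      le_div_iff₀ hx', norm_sub_rev]
    have h1 : Complex.exp (-(Complex.I * (1 : ℤ) * x)) = Complex.exp (Complex.I * (-x : ℝ)) := by
      congr 1; push_cast; ring
    rw [h1, Complex.norm_exp_I_mul_ofReal_sub_one, Real.norm_eq_abs, abs_mul, abs_two]
    have h2 : |Real.sin (-x / 2)| = Real.sin (|x| / 2) := by
      rw [neg_div, Real.sin_neg, abs_neg]
      rcases le_total 0 x with h | h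
      · rw [abs_of_nonneg h] at hx ⊢
        exact abs_of_nonneg (Real.sin_nonneg_of_nonneg_of_le_pi (by linarith) (by linarith))
      · rw [abs_of_nonpos h] at hx ⊢
        rw [neg_div, Real.sin_neg]
        exact abs_of_nonpos (Real.sin_nonpos_of_nonpos_of_neg_pi_le (by linarith) (by linarith))
    rw [h2]
    have h3 := Real.mul_le_sin (x := |x| / 2) (by positivity) (by linarith)
    calc 2 / Real.pi * |x| = 2 * (2 / Real.pi * (|x| / 2)) := by ring
      _ ≤ _ := by gcongr

/-- Zeros can occur only at the countably many points 2πk/μ. -/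
theorem ae_incrKernel_ne_zero {μ : ℤ} (hμ : 0 < μ) : ∀ᵐ x ∂lebPi, incrKernel n μ x ≠ 0 := by
  refine ae_restrict_of_ae ?_
  have hcount : (Set.range fun k : ℤ => (2 * Real.pi * k / μ : ℝ)).Countable :=
    Set.countable_range _
  have hm : (μ : ℂ) ≠ 0 := by exact_mod_cast hμ.ne'
  filter_upwards [hcount.ae_notMem volume] with x hx h0
  apply hx
  unfold incrKernel at h0
  split_ifs at h0 with hx0
  · exact absurd h0 (pow_ne_zero _ hm)
  · rw [div_eq_zero_iff] at h0
    rcases h0 with h0 | h0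
    · have h2 : Complex.exp (-(Complex.I * μ * x)) = 1 := by
        have := eq_zero_of_pow_eq_zero h0
        rw [sub_eq_zero] at this
        exact this.symm
      obtain ⟨k, hk⟩ := Complex.exp_eq_one_iff.1 h2
      refine ⟨-k, ?_⟩
      have h3 : (μ : ℂ) * x = -(2 * Real.pi * k) := by
        have : Complex.I * ((μ : ℂ) * x) = Complex.I * (-(2 * Real.pi * k)) := by
          linear_combination -hk
        exact mul_left_cancel₀ Complex.I_ne_zero this
      have h4 : (μ : ℝ) * x = -(2 * Real.pi * k) := by exact_mod_cast h3
      have h5 : (μ : ℝ) ≠ 0 := by exact_mod_cast hμ.ne'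
      change 2 * Real.pi * ((-k : ℤ) : ℝ) / μ = x
      rw [div_eq_iff h5]
      push_cast
      linarith
    · exact absurd (eq_zero_of_pow_eq_zero h0) (by simp [hx0])

/-- The identity 1 - z^μ = (1 - z)(1 + z + ⋯ + z^{μ-1}) at z = e^{-ix}. -/
theorem incrKernel_eq_mul_geom_sum (μ : ℕ) (x : ℝ) :
    incrKernel n μ x = incrKernel n 1 x *
      (∑ i ∈ Finset.range μ, Complex.exp (Complex.I * (-(i : ℤ) : ℤ) * x)) ^ n := by
  unfold incrKernel
  split_ifs with hx
  · simp [hx]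
  · rw [div_mul_eq_mul_div, ← mul_pow]
    congr 2
    have h1 := mul_neg_geom_sum (Complex.exp (-(Complex.I * (1 : ℤ) * x))) μ
    have h2 : ∀ i : ℕ, Complex.exp (-(Complex.I * (1 : ℤ) * x)) ^ i =
        Complex.exp (Complex.I * (-(i : ℤ) : ℤ) * x) := fun i => by
      rw [← Complex.exp_nat_mul]; congr 1; push_cast; ring
    simp only [h2] at h1
    rw [h1]
    congr 2
    push_cast; ring

end Kernel

/-! ### Spectral images of the increments and their totality. -/

section SpectralVectors

variable (F : Measure ℝ) [IsFiniteMeasure F] (n : ℕ)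

theorem memLp_exp_mul_incrKernel (m μ : ℤ) :
    MemLp (fun x : ℝ => Complex.exp (Complex.I * m * x) * incrKernel n μ x) 2 F := by
  refine MemLp.of_bound (C := |(μ : ℝ)| ^ n)
    ((measurable_exp_I_mul m).mul (measurable_incrKernel n μ)).aestronglyMeasurable
    (Eventually.of_forall fun x => ?_)
  rw [norm_mul, norm_exp_I_mul_int, one_mul]
  exact norm_incrKernel_le n μ x

/-- The spectral image `e^{imx} (1 - e^{-iμx})^n (ix)^{-n}` of an increment in `L₂(F)`. -/
noncomputable def specLp (m μ : ℤ) : Lp ℂ 2 F := (memLp_exp_mul_incrKernel F n m μ).toLp _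

theorem coeFn_specLp (m μ : ℤ) :
    specLp F n m μ =ᵐ[F] fun x => Complex.exp (Complex.I * m * x) * incrKernel n μ x :=
  MemLp.coeFn_toLp _

theorem integrable_conj_mul {g g' : ℝ → ℂ} {ν : Measure ℝ} (hg : MemLp g 2 ν) (hg' : MemLp g' 2 ν) :
    Integrable (fun x => conj (g x) * g' x) ν :=
  MemLp.integrable_mul hg.star hg'

variable {F} {n}

/-- The inner products are the Fourier coefficients of conj(K_μ) g ρ. Fourier uniqueness makes this
product vanish, and K_μ and ρ can be divided out almost everywhere. -/
theorem HasBoundedDensity.eq_zero_of_inner_specLp {ρ : ℝ → ℝ} {c C : ℝ}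
    (h : HasBoundedDensity F ρ c C) {μ : ℤ} (hμ : 0 < μ) {g : Lp ℂ 2 F}
    (hg : ∀ k, inner ℂ (specLp F n k μ) g = 0) : g = 0 := by
  have h0 : (fun x => conj (incrKernel n μ x) * g x) =ᵐ[F] 0 := by
    refine h.ae_eq_zero_of_integral_exp ?_ fun j => ?_
    · have h1 := memLp_exp_mul_incrKernel F n 0 μ
      simp only [Int.cast_zero, mul_zero, zero_mul, Complex.exp_zero, one_mul] at h1
      exact integrable_conj_mul h1 (Lp.memLp g)
    · rw [← hg (-j), inner_eq_integral (coeFn_specLp F n (-j) μ) (EventuallyEq.refl _ _)]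
      congr 1; ext x
      rw [map_mul, conj_exp_I_mul, neg_neg]
      ring
  refine Lp.ext ?_
  filter_upwards [h0, h.absolutelyContinuous.ae_le (ae_incrKernel_ne_zero n hμ),
    Lp.coeFn_zero ℂ 2 F] with x hx hx' hz
  rw [hz]
  simpa [hx'] using hx

theorem HasBoundedDensity.closedSpan_specLp {ρ : ℝ → ℝ} {c C : ℝ}
    (h : HasBoundedDensity F ρ c C) {μ : ℤ} (hμ : 0 < μ) :
    closedSpan (Set.range fun k => specLp F n k μ) = ⊤ := by
  refine eq_top_iff.2 fun x _ => mem_closedSpan_of_orthogonal fun y hy => ?_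
  rw [h.eq_zero_of_inner_specLp hμ fun k => hy _ ⟨k, rfl⟩, inner_zero_right]

end SpectralVectors

/-! ### Spectral isometry and stochastic integrals. -/

section StochasticIntegral

variable {Ω : Type*} [MeasurableSpace Ω] {P : Measure Ω} {ξ : ℤ → Ω → ℂ} {n : ℕ} {F : Measure ℝ}

theorem StationaryIncrements.coeFn_incrLp (h : StationaryIncrements P ξ n) (m μ : ℤ) :
    h.incrLp m μ =ᵐ[P] incr ξ n m μ :=
  MemLp.coeFn_toLp _

theorem IsSpectralMeasure.inner_incrLp (h : StationaryIncrements P ξ n)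
    (hf : IsSpectralMeasure P ξ n F) [IsFiniteMeasure F] (m₁ μ₁ m₂ μ₂ : ℤ) :
    inner ℂ (h.incrLp m₁ μ₁) (h.incrLp m₂ μ₂) =
      inner ℂ (specLp F n m₁ μ₁) (specLp F n m₂ μ₂) := by
  rw [inner_eq_integral (h.coeFn_incrLp m₁ μ₁) (h.coeFn_incrLp m₂ μ₂),
    inner_eq_integral (coeFn_specLp F n m₁ μ₁) (coeFn_specLp F n m₂ μ₂)]
  have := hf.2.2 m₁ (m₂ - m₁) μ₂ μ₁
  rw [add_sub_cancel] at this
  rw [this]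
  congr 1; ext x
  have h1 := exp_I_mul_add m₂ (-m₁) x
  rw [← sub_eq_add_neg] at h1
  rw [h1.symm, map_mul, conj_exp_I_mul]
  ring

/-- The spectral isometry from `L₂(F)` onto the closed span of the increments. -/
theorem exists_spectralIsometry (h : StationaryIncrements P ξ n) (hf : IsSpectralMeasure P ξ n F)
    {ρ : ℝ → ℝ} {c C : ℝ} (hF : HasBoundedDensity F ρ c C) [IsFiniteMeasure F] :
    ∃ V : Lp ℂ 2 F →ₗᵢ[ℂ] Lp ℂ 2 P, ∀ m μ, V (specLp F n m μ) = h.incrLp m μ := by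
  have hd : closedSpan (Set.range fun p : ℤ × ℤ => specLp F n p.1 p.2) = ⊤ := by
    rw [eq_top_iff, ← hF.closedSpan_specLp (n := n) one_pos]
    refine closedSpan_mono ?_
    rintro _ ⟨k, rfl⟩
    exact ⟨(k, 1), rfl⟩
  obtain ⟨V, hV⟩ := exists_linearIsometry_of_inner_eq (b := fun p : ℤ × ℤ => h.incrLp p.1 p.2) hd
    fun i j => (hf.inner_incrLp h _ _ _ _).symm
  exact ⟨V, fun m μ => hV (m, μ)⟩

theorem SimpleFunc.eq_sum_indicator {α : Type*} [MeasurableSpace α] (s : SimpleFunc α ℂ) (x : α) :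
    s x = ∑ c ∈ s.range, (s ⁻¹' {c}).indicator (fun _ => c) x := by
  rw [Finset.sum_eq_single (s x)]
  · simp
  · intro c _ hc
    exact Set.indicator_of_notMem (fun h => hc h.symm) _
  · intro h
    exact absurd (s.mem_range_self x) h

/-- The Itô isometry for simple functions: both sides expand over intersections of level sets.
`HasStochIntegral.inner_eq` passes to the limit. -/
theorem IsOrthogonalStochasticMeasure.inner_simpleStochIntegral [IsFiniteMeasure F]
    {Z : Set ℝ → Lp ℂ 2 P} (hZ : IsOrthogonalStochasticMeasure F Z) (s t : SimpleFunc ℝ ℂ) :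
    inner ℂ (simpleStochIntegral Z s) (simpleStochIntegral Z t) = ∫ x, t x * conj (s x) ∂F := by
  have hA : ∀ A B, MeasurableSet A → MeasurableSet B →
      inner ℂ (Z A) (Z B) = (F.real (A ∩ B) : ℂ) := fun A B hA hB => by
    rw [inner_eq_integral (EventuallyEq.refl _ _) (EventuallyEq.refl _ _), hZ B A hB hA,
      Set.inter_comm]
  have hpt : ∀ x, t x * conj (s x) = ∑ c ∈ s.range, ∑ d ∈ t.range,
      (s ⁻¹' {c} ∩ t ⁻¹' {d}).indicator (fun _ => conj c * d) x := by
    intro x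
    conv_lhs => rw [SimpleFunc.eq_sum_indicator s x, SimpleFunc.eq_sum_indicator t x]
    rw [map_sum, mul_comm, Finset.sum_mul_sum]
    refine Finset.sum_congr rfl fun c _ => Finset.sum_congr rfl fun d _ => ?_
    by_cases h1 : x ∈ s ⁻¹' {c} <;> by_cases h2 : x ∈ t ⁻¹' {d} <;> simp_all [Set.indicator]
  simp_rw [hpt]
  have hm : ∀ c d, MeasurableSet (s ⁻¹' {c} ∩ t ⁻¹' {d}) := fun c d =>
    (s.measurableSet_fiber c).inter (t.measurableSet_fiber d)
  have hi : ∀ c d, Integrable ((s ⁻¹' {c} ∩ t ⁻¹' {d}).indicator fun _ => conj c * d) F :=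
    fun c d => (integrable_const _).indicator (hm c d)
  rw [integral_finsetSum _ fun c _ => integrable_finsetSum _ fun d _ => hi c d, simpleStochIntegral,
    simpleStochIntegral, sum_inner]
  refine Finset.sum_congr rfl fun c _ => ?_
  rw [integral_finsetSum _ fun d _ => hi c d, inner_sum]
  refine Finset.sum_congr rfl fun d _ => ?_
  rw [inner_smul_left, inner_smul_right, hA _ _ (s.measurableSet_fiber c) (t.measurableSet_fiber d),
    integral_indicator_const _ (hm c d), Complex.real_smul]
  ring

theorem tendsto_toLp_simpleFunc [IsFiniteMeasure F] {g : ℝ → ℂ} (hg : MemLp g 2 F)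
    {s : ℕ → SimpleFunc ℝ ℂ}
    (hs : Tendsto (fun N => eLpNorm (fun x => g x - s N x) 2 F) atTop (𝓝 0)) :
    Tendsto (fun N => ((s N).memLp_of_isFiniteMeasure 2 F).toLp (s N)) atTop (𝓝 (hg.toLp g)) := by
  rw [Lp.tendsto_Lp_iff_tendsto_eLpNorm'']
  refine hs.congr fun N => ?_
  exact eLpNorm_sub_comm _ _ _ _

theorem HasStochIntegral.inner_eq [IsFiniteMeasure F] {Z : Set ℝ → Lp ℂ 2 P}
    (hZ : IsOrthogonalStochasticMeasure F Z) {g g' : ℝ → ℂ} {X X' : Lp ℂ 2 P}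
    (h : HasStochIntegral F Z g X) (h' : HasStochIntegral F Z g' X') :
    inner ℂ X X' = inner ℂ (h.1.toLp g) (h'.1.toLp g') := by
  obtain ⟨s, hs, hsX⟩ := h.2
  obtain ⟨t, ht, htX⟩ := h'.2
  refine tendsto_nhds_unique (hsX.inner htX) ?_
  refine ((tendsto_toLp_simpleFunc h.1 hs).inner (tendsto_toLp_simpleFunc h'.1 ht)).congr
    fun N => ?_
  rw [hZ.inner_simpleStochIntegral, inner_eq_integral (MemLp.coeFn_toLp _) (MemLp.coeFn_toLp _)]

theorem exists_simpleFunc_tendsto {g : ℝ → ℂ} (hg : MemLp g 2 F) :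
    ∃ s : ℕ → SimpleFunc ℝ ℂ,
      Tendsto (fun N => eLpNorm (fun x => g x - s N x) 2 F) atTop (𝓝 0) := by
  have hpos : ∀ N : ℕ, ((N : ℝ≥0∞) + 1)⁻¹ ≠ 0 := fun N =>
    ENNReal.inv_ne_zero.2 (by finiteness)
  choose s hs _ using fun N : ℕ => hg.exists_simpleFunc_eLpNorm_sub_lt (by simp) (hpos N)
  refine ⟨s, tendsto_of_tendsto_of_tendsto_of_le_of_le tendsto_const_nhds ?_
    (fun N => zero_le) fun N => (hs N).le⟩
  have := ENNReal.tendsto_inv_nat_nhds_zero.comp (tendsto_add_atTop_nat 1)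
  refine this.congr fun N => ?_
  simp

theorem HasStochIntegral.simpleFunc [IsFiniteMeasure F] (Z : Set ℝ → Lp ℂ 2 P)
    (s : SimpleFunc ℝ ℂ) : HasStochIntegral F Z s (simpleStochIntegral Z s) :=
  ⟨s.memLp_of_isFiniteMeasure 2 F, fun _ => s, by simp, tendsto_const_nhds⟩

/-- The stochastic integral of every spectral representation is the spectral isometry. -/
theorem IsSpectralRepresentation.hasStochIntegral_iff [IsFiniteMeasure F]
    {h : StationaryIncrements P ξ n} {ρ : ℝ → ℝ} {c C : ℝ} (hF : HasBoundedDensity F ρ c C)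
    {V : Lp ℂ 2 F →ₗᵢ[ℂ] Lp ℂ 2 P} (hV : ∀ m μ, V (specLp F n m μ) = h.incrLp m μ)
    {Z : Set ℝ → Lp ℂ 2 P} (hZ : IsSpectralRepresentation h F Z) {g : ℝ → ℂ} {X : Lp ℂ 2 P} :
    HasStochIntegral F Z g X ↔ ∃ hg : MemLp g 2 F, X = V (hg.toLp g) := by
  have key : ∀ {g : ℝ → ℂ} {X : Lp ℂ 2 P} (H : HasStochIntegral F Z g X),
      X = V (H.1.toLp g) := by
    intro g X H
    set G := H.1.toLp g
    -- `X` is not known to lie in the range of `V`. Pairing with increments shows that `V G` is its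
    -- projection onto that range; the Itô isometry gives both the same norm, so they coincide.
    have h1 : ∀ y, inner ℂ (V y) (X - V G) = 0 := by
      intro y
      have hy : y ∈ closedSpan (Set.range fun k => specLp F n k 1) := by
        rw [hF.closedSpan_specLp one_pos]; trivial
      have hVy : V y ∈ closedSpan (V '' Set.range fun k => specLp F n k 1) := by
        rw [← map_closedSpan]; exact ⟨y, hy, rfl⟩
      refine inner_eq_zero_of_mem_closedSpan ?_ hVy
      rintro _ ⟨_, ⟨k, rfl⟩, rfl⟩
      rw [inner_sub_right, V.inner_map_map]
      change inner ℂ (V (specLp F n k 1)) X - _ = 0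
      rw [hV, HasStochIntegral.inner_eq hZ.orthogonal (hZ.repr k 1) H, sub_eq_zero]
      rfl
    have h2 : inner ℂ X X = inner ℂ G G := H.inner_eq hZ.orthogonal H
    have h3 : inner ℂ (V G) X = inner ℂ G G := by
      have := h1 G
      rwa [inner_sub_right, V.inner_map_map, sub_eq_zero] at this
    have h4 : inner ℂ X (V G) = inner ℂ G G := by
      rw [← inner_conj_symm, h3, inner_conj_symm]
    rw [← sub_eq_zero, ← inner_self_eq_zero (𝕜 := ℂ), inner_sub_left, h1 G, sub_zero,
      inner_sub_right, h2, h4, sub_self]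
  refine ⟨fun H => ⟨H.1, key H⟩, ?_⟩
  rintro ⟨hg, rfl⟩
  obtain ⟨s, hs⟩ := exists_simpleFunc_tendsto hg
  refine ⟨hg, s, hs, ?_⟩
  refine ((V.continuous.tendsto _).comp (tendsto_toLp_simpleFunc hg hs)).congr fun N => ?_
  exact (key (HasStochIntegral.simpleFunc Z (s N))).symm

/-- Take Z(A) to be the image under `V` of the indicator of A. -/
theorem exists_isSpectralRepresentation [IsFiniteMeasure F]
    {h : StationaryIncrements P ξ n}
    {V : Lp ℂ 2 F →ₗᵢ[ℂ] Lp ℂ 2 P} (hV : ∀ m μ, V (specLp F n m μ) = h.incrLp m μ) :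
    ∃ Z : Set ℝ → Lp ℂ 2 P, IsSpectralRepresentation h F Z := by
  classical
  let Z : Set ℝ → Lp ℂ 2 P := fun A =>
    if hA : MeasurableSet A then V (indicatorConstLp 2 hA (measure_ne_top F A) 1) else 0
  have hZ : ∀ {A} (hA : MeasurableSet A),
      Z A = V (indicatorConstLp 2 hA (measure_ne_top F A) 1) := fun hA => by simp [Z, hA]
  have hsimple : ∀ s : SimpleFunc ℝ ℂ,
      simpleStochIntegral Z s = V ((s.memLp_of_isFiniteMeasure 2 F).toLp s) := by
    intro s
    have h1 : (s.memLp_of_isFiniteMeasure 2 F).toLp s = ∑ c ∈ s.range,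
        c • indicatorConstLp 2 (s.measurableSet_fiber c) (measure_ne_top F _) (1 : ℂ) := by
      refine Lp.ext ?_
      have h2 : ∀ᵐ x ∂F, ∀ c ∈ s.range,
          (c • indicatorConstLp 2 (s.measurableSet_fiber c) (measure_ne_top F _) (1 : ℂ) :
            Lp ℂ 2 F) x = (s ⁻¹' {c}).indicator (fun _ => c) x := by
        refine (Finset.eventually_all _).2 fun c _ => ?_
        filter_upwards [Lp.coeFn_smul c (indicatorConstLp 2 (s.measurableSet_fiber c)
            (measure_ne_top F _) (1 : ℂ)), indicatorConstLp_coeFn (p := 2)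
            (hs := s.measurableSet_fiber c) (hμs := measure_ne_top F _) (c := (1 : ℂ))] with x hx hx'
        rw [hx, Pi.smul_apply, hx']
        by_cases hm : x ∈ s ⁻¹' {c} <;> simp [Set.indicator, hm]
      filter_upwards [MemLp.coeFn_toLp (s.memLp_of_isFiniteMeasure 2 F), h2,
        Lp.coeFn_finsetSum s.range fun c => c • indicatorConstLp 2 (s.measurableSet_fiber c)
            (measure_ne_top F _) (1 : ℂ)] with x hx hx' hx''
      rw [hx, hx'', Finset.sum_apply, SimpleFunc.eq_sum_indicator s x]
      exact Finset.sum_congr rfl fun c hc => (hx' c hc).symm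
    rw [h1, map_sum, simpleStochIntegral]
    refine Finset.sum_congr rfl fun c _ => ?_
    rw [map_smul, hZ (s.measurableSet_fiber c)]
  refine ⟨Z, ⟨fun A B hA hB => ?_, fun m μ => ?_⟩⟩
  · have h1 := inner_eq_integral (EventuallyEq.refl _ (Z B)) (EventuallyEq.refl _ (Z A))
    rw [← h1, hZ hA, hZ hB, V.inner_map_map, L2.inner_indicatorConstLp_one,
      setIntegral_congr_ae (g := A.indicator fun _ => (1 : ℂ)) hB
        (by filter_upwards [indicatorConstLp_coeFn (p := 2) (hs := hA)
              (hμs := measure_ne_top F _) (c := (1 : ℂ))] with x hx _ using hx),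
      integral_indicator_const _ hA]
    simp [measureReal_restrict_apply hA]
  · have hg := memLp_exp_mul_incrKernel F n m μ
    obtain ⟨s, hs⟩ := exists_simpleFunc_tendsto hg
    refine ⟨hg, s, hs, ?_⟩
    rw [← hV m μ]
    refine ((V.continuous.tendsto _).comp (tendsto_toLp_simpleFunc hg hs)).congr fun N => ?_
    exact (hsimple (s N)).symm

end StochasticIntegral

/-! ### Inverting window sums. -/

/-- A sequence that vanishes at `-∞` and whose sums over windows of length `μ` vanish up to time
`t` vanishes up to time `t`. -/
theorem eq_zero_of_window_sum_eq_zero {c : ℤ → ℂ} (hc : Tendsto c atBot (𝓝 0)) {μ : ℕ}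
    (hμ : 0 < μ) {t : ℤ} (h : ∀ k ≤ t, ∑ i ∈ Finset.range μ, c (k - i) = 0) :
    ∀ k ≤ t, c k = 0 := by
  have hper : ∀ k ≤ t, c (k - μ) = c k := by
    intro k hk
    -- Adjacent windows differ only in their end terms, so the sequence has period `μ` up to time
    -- `t`; decay at -∞ then forces it to vanish.
    have h1 := Finset.sum_range_sub' (fun i : ℕ => c (k - i)) μ
    have h2 := h (k - 1) (by omega)
    have h3 : ∑ i ∈ Finset.range μ, c (k - ((i + 1 : ℕ) : ℤ)) = 0 := by
      rw [← h2]
      refine Finset.sum_congr rfl fun i _ => ?_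
      congr 1; push_cast; ring
    rw [Finset.sum_sub_distrib, h k hk, h3] at h1
    simp only [sub_self, CharP.cast_eq_zero, sub_zero] at h1
    exact (sub_eq_zero.1 h1.symm).symm
  intro k hk
  have hN : ∀ N : ℕ, c (k - N * μ) = c k := by
    intro N
    induction N with
    | zero => simp
    | succ N ih =>
      have hle : k - N * μ ≤ t := by
        have : (0 : ℤ) ≤ N * μ := by positivity
        omega
      rw [← ih, ← hper _ hle]
      congr 1; push_cast; ring
  have hlim : Tendsto (fun N : ℕ => c (k - N * μ)) atTop (𝓝 0) := by
    refine hc.comp (tendsto_atBot.2 fun b => ?_)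
    filter_upwards [eventually_ge_atTop (k - b).toNat] with N hN'
    have h1 := Int.self_le_toNat (k - b)
    have h2 : (N : ℤ) ≤ N * μ := le_mul_of_one_le_right (by positivity) (by omega)
    omega
  simp_rw [hN] at hlim
  exact tendsto_nhds_unique tendsto_const_nhds hlim

/-! ### The time shift as multiplication by exponentials. -/

section Shift

variable (F : Measure ℝ)

theorem exists_expShift :
    ∃ S : ℤ → Lp ℂ 2 F →ₗᵢ[ℂ] Lp ℂ 2 F,
      ∀ j g, S j g =ᵐ[F] fun x => Complex.exp (Complex.I * j * x) * g x := by
  have hex : ∀ j : ℤ, ∃ A : Lp ℂ 2 F →ₗᵢ[ℂ] Lp ℂ 2 F,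
      ∀ g, A g =ᵐ[F] fun x => Complex.exp (Complex.I * j * x) * g x := by
    intro j
    obtain ⟨A, hA⟩ := exists_mul_clm (lam := F) (ν := F) (C := 1) (by simp) (by simp)
      (measurable_exp_I_mul j).aestronglyMeasurable (K := 1)
      (Eventually.of_forall fun x => (norm_exp_I_mul_int j x).le)
    refine ⟨⟨A.toLinearMap, fun g => ?_⟩, hA⟩
    change ‖A g‖ = ‖g‖
    refine (pow_left_inj₀ (norm_nonneg _) (norm_nonneg _) two_ne_zero).1 ?_
    rw [norm_sq_eq_integral, norm_sq_eq_integral]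
    refine integral_congr_ae ?_
    filter_upwards [hA g] with x hx
    rw [hx, norm_mul, norm_exp_I_mul_int, one_mul]
  choose S hS using hex
  exact ⟨S, hS⟩

/-- Multiplication by `e^{ijx}` as an isometry of `L₂(F)`. -/
noncomputable def expShift (j : ℤ) : Lp ℂ 2 F →ₗᵢ[ℂ] Lp ℂ 2 F := (exists_expShift F).choose j

theorem coeFn_expShift (j : ℤ) (g : Lp ℂ 2 F) :
    expShift F j g =ᵐ[F] fun x => Complex.exp (Complex.I * j * x) * g x :=
  (exists_expShift F).choose_spec j g

variable {F}

theorem expShift_expShift (i j : ℤ) (g : Lp ℂ 2 F) :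
    expShift F i (expShift F j g) = expShift F (i + j) g := by
  refine Lp.ext ?_
  filter_upwards [coeFn_expShift F i (expShift F j g), coeFn_expShift F j g,
    coeFn_expShift F (i + j) g] with x h1 h2 h3
  rw [h1, h2, h3, ← mul_assoc, exp_I_mul_add]

theorem expShift_zero (g : Lp ℂ 2 F) : expShift F 0 g = g := by
  refine Lp.ext ?_
  filter_upwards [coeFn_expShift F 0 g] with x h1
  rw [h1]; simp

theorem expShift_specLp [IsFiniteMeasure F] (n : ℕ) (j m μ : ℤ) :
    expShift F j (specLp F n m μ) = specLp F n (j + m) μ := by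
  refine Lp.ext ?_
  filter_upwards [coeFn_expShift F j (specLp F n m μ), coeFn_specLp F n m μ,
    coeFn_specLp F n (j + m) μ] with x h1 h2 h3
  rw [h1, h2, h3, ← mul_assoc, exp_I_mul_add]

theorem inner_expShift (j : ℤ) (g g' : Lp ℂ 2 F) :
    inner ℂ (expShift F j g) g' = inner ℂ g (expShift F (-j) g') := by
  rw [← (expShift F (-j)).inner_map_map, expShift_expShift, neg_add_cancel, expShift_zero]

/-- The Riemann–Lebesgue lemma for the function ρ conj(g) g'. -/
theorem HasBoundedDensity.tendsto_inner_expShift {ρ : ℝ → ℝ} {c C : ℝ}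
    (h : HasBoundedDensity F ρ c C) (g g' : Lp ℂ 2 F) :
    Tendsto (fun k => inner ℂ (expShift F k g) g') atBot (𝓝 0) := by
  have hRL := Real.tendsto_integral_exp_smul_cocompact
    ((Set.Ico (-Real.pi) Real.pi).indicator fun x => (ρ x : ℂ) * (conj (g x) * g' x))
  -- The Fourier character is e^{2πix}, so the integer frequency k is rescaled by 2π.
  have hk : Tendsto (fun k : ℤ => (k : ℝ) / (2 * Real.pi)) atBot (cocompact ℝ) :=
    (((tendsto_intCast_atBot_iff (R := ℝ)).2 tendsto_id).atBot_div_const Real.two_pi_pos).mono_right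
      atBot_le_cocompact
  refine (hRL.comp hk).congr fun k => ?_
  rw [inner_eq_integral (coeFn_expShift F k g) (EventuallyEq.refl _ _), h.integral_eq,
    ← integral_indicator measurableSet_Ico]
  refine integral_congr_ae (Eventually.of_forall fun x => ?_)
  by_cases hx : x ∈ Set.Ico (-Real.pi) Real.pi
  · simp only [Set.indicator_of_mem hx]
    rw [Circle.smul_def, Real.fourierChar_apply, smul_eq_mul, map_mul, conj_exp_I_mul]
    have : Complex.exp (2 * Real.pi * (-(x * ((k : ℝ) / (2 * Real.pi))) : ℝ) * Complex.I) =
        Complex.exp (Complex.I * (-k : ℤ) * x) := by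
      congr 1
      have := Real.pi_pos.ne'
      push_cast
      field_simp
    push_cast at this ⊢
    rw [this]
    ring
  · simp only [Set.indicator_of_notMem hx, smul_zero]

end Shift

/-! ### Independence of the past from the step, and the biorthogonal family. -/

section Past

variable {F : Measure ℝ} {n : ℕ}

/-- The closed span of the spectral images of the increments with step `μ` up to time `t`. -/
noncomputable abbrev specPast (F : Measure ℝ) [IsFiniteMeasure F] (n : ℕ) (μ t : ℤ) :
    Submodule ℂ (Lp ℂ 2 F) :=
  closedSpan {x | ∃ m : ℤ, m ≤ t ∧ x = specLp F n m μ}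

/-- Multiplication by `∑_{k < μ} e^{-ikx}` on `L₂(F)`. -/
noncomputable def windowSum (F : Measure ℝ) (μ : ℕ) : Lp ℂ 2 F →L[ℂ] Lp ℂ 2 F :=
  ∑ i ∈ Finset.range μ, (expShift F (-(i : ℤ))).toContinuousLinearMap

theorem windowSum_apply (μ : ℕ) (g : Lp ℂ 2 F) :
    windowSum F μ g = ∑ i ∈ Finset.range μ, expShift F (-(i : ℤ)) g := by
  simp [windowSum]

theorem windowSum_expShift (μ : ℕ) (k : ℤ) (g : Lp ℂ 2 F) :
    windowSum F μ (expShift F k g) = expShift F k (windowSum F μ g) := by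
  simp_rw [windowSum_apply, map_sum, expShift_expShift, add_comm]

theorem coeFn_windowSum (μ : ℕ) (g : Lp ℂ 2 F) : windowSum F μ g =ᵐ[F] fun x =>
    (∑ i ∈ Finset.range μ, Complex.exp (Complex.I * (-(i : ℤ) : ℤ) * x)) * g x := by
  rw [windowSum_apply]
  have h : ∀ᵐ x ∂F, ∀ i ∈ Finset.range μ, expShift F (-(i : ℤ)) g x =
      Complex.exp (Complex.I * (-(i : ℤ) : ℤ) * x) * g x :=
    (Finset.eventually_all _).2 fun i _ => coeFn_expShift F _ g
  filter_upwards [h, Lp.coeFn_finsetSum (Finset.range μ) fun i : ℕ => expShift F (-(i : ℤ)) g]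
    with x h1 h2
  rw [h2, Finset.sum_apply, Finset.sum_mul]
  exact Finset.sum_congr rfl h1

variable [IsFiniteMeasure F]

theorem windowSum_pow_specLp (μ : ℕ) (m : ℤ) :
    (windowSum F μ ^ n) (specLp F n m 1) = specLp F n m μ := by
  have key : ∀ k : ℕ, (windowSum F μ ^ k) (specLp F n m 1) =ᵐ[F] fun x =>
      (∑ i ∈ Finset.range μ, Complex.exp (Complex.I * (-(i : ℤ) : ℤ) * x)) ^ k *
        (Complex.exp (Complex.I * m * x) * incrKernel n 1 x) := by
    intro k
    induction k with
    | zero => simpa using coeFn_specLp F n m 1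
    | succ k ih =>
      rw [pow_succ']
      filter_upwards [ih, coeFn_windowSum μ ((windowSum F μ ^ k) (specLp F n m 1))] with x h1 h2
      change windowSum F μ ((windowSum F μ ^ k) (specLp F n m 1)) x = _
      rw [h2, h1]; ring
  refine Lp.ext ?_
  filter_upwards [key n, coeFn_specLp F n m μ] with x h1 h2
  rw [h1, h2, incrKernel_eq_mul_geom_sum]
  ring

/-- The window sum only shifts backwards in time, so it preserves the unit step past; its n-th power
produces the increment with step `μ`. -/
theorem specLp_mem_specPast_one {μ : ℤ} (hμ : 0 < μ) {m t : ℤ} (hm : m ≤ t) :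
    specLp F n m μ ∈ specPast F n 1 t := by
  lift μ to ℕ using hμ.le
  have hQ : ∀ x ∈ specPast F n 1 t, windowSum F μ x ∈ specPast F n 1 t := by
    intro x hx
    have : specPast F n 1 t ≤ (specPast F n 1 t).comap (windowSum F μ).toLinearMap := by
      refine closedSpan_le ((isClosed_closedSpan _).preimage (windowSum F μ).continuous) ?_
      rintro _ ⟨k, hk, rfl⟩
      change windowSum F μ _ ∈ specPast F n 1 t
      rw [windowSum_apply]
      refine Submodule.sum_mem _ fun i _ => subset_closedSpan ⟨-(i : ℤ) + k, by omega, ?_⟩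
      rw [expShift_specLp]
    exact this hx
  rw [← windowSum_pow_specLp]
  have : ∀ k : ℕ, (windowSum F μ ^ k) (specLp F n m 1) ∈ specPast F n 1 t := by
    intro k
    induction k with
    | zero => exact subset_closedSpan ⟨m, hm, by simp⟩
    | succ k ih => rw [pow_succ']; exact hQ _ ih
  exact this n

/-- The hard inclusion goes by duality: a vector orthogonal to the past with step `μ` must be
orthogonal to the unit step past. The window factors are removed one at a time, with
`eq_zero_of_window_sum_eq_zero` applied to inner products that decay at -∞. -/
theorem HasBoundedDensity.specPast_eq {ρ : ℝ → ℝ} {c C : ℝ} (h : HasBoundedDensity F ρ c C)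
    {μ : ℤ} (hμ : 0 < μ) (t : ℤ) : specPast F n μ t = specPast F n 1 t := by
  refine le_antisymm (closedSpan_le (isClosed_closedSpan _) ?_)
    (closedSpan_le (isClosed_closedSpan _) ?_)
  · rintro _ ⟨m, hm, rfl⟩
    exact specLp_mem_specPast_one hμ hm
  · lift μ to ℕ using hμ.le
    rintro _ ⟨m, hm, rfl⟩
    refine mem_closedSpan_of_orthogonal fun y hy => ?_
    -- `j` counts the window factors already removed: `j = 0` is the hypothesis on `y`, and `j = n`
    -- is the unit step.
    have key : ∀ j ≤ n, ∀ k ≤ t,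
        inner ℂ (expShift F k ((windowSum F μ ^ (n - j)) (specLp F n 0 1))) y = 0 := by
      intro j
      induction j with
      | zero =>
        intro _ k hk
        rw [Nat.sub_zero, windowSum_pow_specLp, expShift_specLp, add_zero]
        exact hy _ ⟨k, hk, rfl⟩
      | succ j ih =>
        intro hj
        refine eq_zero_of_window_sum_eq_zero (h.tendsto_inner_expShift _ _)
          (by exact_mod_cast hμ) fun k hk => ?_
        have h1 := ih (by omega) k hk
        rw [show n - j = n - (j + 1) + 1 by omega, pow_succ'] at h1
        change inner ℂ (expShift F k (windowSum F μ _)) y = 0 at h1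
        rw [← windowSum_expShift, windowSum_apply, sum_inner] at h1
        simp_rw [expShift_expShift] at h1
        rw [← h1]
        refine Finset.sum_congr rfl fun i _ => ?_
        rw [show -(i : ℤ) + k = k - i by ring]
        rfl
    have := key n le_rfl m hm
    rwa [Nat.sub_self, pow_zero, one_apply_eq_self, expShift_specLp, add_zero] at this

/-- A total sequence in `L₂(F)` which is biorthogonal to the spectral images of the unit step
increments. -/
theorem HasBoundedDensity.exists_biorthogonal {ρ : ℝ → ℝ} {c C : ℝ}
    (h : HasBoundedDensity F ρ c C) :
    ∃ d : ℤ → Lp ℂ 2 F,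
      (∀ j m, inner ℂ (d j) (specLp F n m 1) = if j = m then (2 * Real.pi : ℂ) else 0) ∧
      ∀ g, (∀ j, inner ℂ (d j) g = 0) → g = 0 := by
  -- Chosen so that conj(w) K_1 ρ = 1: pairing with e^{imx} K_1 in L₂(F) leaves a pure exponential
  -- integral. The lower bounds on K_1 and ρ keep `w` bounded.
  set w : ℝ → ℂ := fun x => (conj (incrKernel n 1 x) * ρ x)⁻¹ with hw
  have hwm : Measurable w :=
    (((Complex.continuous_conj.measurable.comp (measurable_incrKernel n 1))).mul
      (Complex.measurable_ofReal.comp h.measurable)).inv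
  have hpi : 0 < (2 / Real.pi) ^ n := by positivity
  have hbd : ∀ᵐ x ∂F, (2 / Real.pi) ^ n ≤ ‖incrKernel n 1 x‖ := by
    refine h.absolutelyContinuous.ae_le ?_
    filter_upwards [ae_restrict_mem measurableSet_Ico] with x hx
    exact le_norm_incrKernel_one n (abs_le.2 ⟨hx.1, hx.2.le⟩)
  have hmem : ∀ j : ℤ, MemLp (fun x : ℝ => Complex.exp (Complex.I * j * x) * w x) 2 F := fun j => by
    refine MemLp.of_bound ((measurable_exp_I_mul j).mul hwm).aestronglyMeasurable
      (((2 / Real.pi) ^ n * c)⁻¹) ?_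
    filter_upwards [hbd] with x hx
    rw [norm_mul, norm_exp_I_mul_int, one_mul, hw, norm_inv, norm_mul, RCLike.norm_conj,
      Complex.norm_real, Real.norm_of_nonneg (h.ρ_pos x).le]
    have := h.pos
    have := h.lower x
    gcongr
  have hin : ∀ j g, inner ℂ ((hmem j).toLp _) g =
      ∫ x, Complex.exp (Complex.I * (-j : ℤ) * x) * (conj (w x) * g x) ∂F := fun j g => by
    rw [inner_eq_integral (MemLp.coeFn_toLp (hmem j)) (EventuallyEq.refl _ g)]
    congr 1; ext x
    rw [map_mul, conj_exp_I_mul]; ring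
  have hne : ∀ x, (2 / Real.pi) ^ n ≤ ‖incrKernel n 1 x‖ → incrKernel n 1 x ≠ 0 := fun x hx =>
    norm_pos_iff.1 (hpi.trans_le hx)
  have hρ : ∀ x, (ρ x : ℂ) ≠ 0 := fun x => by exact_mod_cast (h.ρ_pos x).ne'
  refine ⟨fun j => (hmem j).toLp _, fun j m => ?_, fun g hg => ?_⟩
  · have h1 : inner ℂ ((hmem j).toLp _) (specLp F n m 1) =
        ∫ x, Complex.exp (Complex.I * (m - j : ℤ) * x) ∂lebPi := by
      rw [hin]
      calc _ = ∫ x, Complex.exp (Complex.I * (m - j : ℤ) * x) * (ρ x : ℂ)⁻¹ ∂F := by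
            refine integral_congr_ae ?_
            filter_upwards [coeFn_specLp F n m 1, hbd] with x hx hx'
            have h2 := hne x hx'
            have h3 := hρ x
            rw [hx, hw, sub_eq_neg_add, ← exp_I_mul_add]
            simp only [map_inv₀, map_mul, Complex.conj_conj, Complex.conj_ofReal]
            field_simp
        _ = _ := by
            rw [h.integral_eq]
            congr 1; ext x
            have h3 := hρ x
            field_simp
    rw [h1, integral_exp_lebPi]
    have : m - j = 0 ↔ j = m := by omega
    simp only [this]
  · have h0 : (fun x => conj (w x) * g x) =ᵐ[F] 0 := by
      refine h.ae_eq_zero_of_integral_exp ?_ fun j => ?_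
      · have h1 := hmem 0
        simp only [Int.cast_zero, mul_zero, zero_mul, Complex.exp_zero, one_mul] at h1
        exact integrable_conj_mul h1 (Lp.memLp g)
      · rw [← hg (-j), hin, neg_neg]
    refine Lp.ext ?_
    filter_upwards [h0, hbd, Lp.coeFn_zero ℂ 2 F] with x hx hx' hz
    rw [hz]
    simpa [hw, hne x hx', hρ x] using hx

end Past

/-! ### Past spaces and existence of canonical representations. -/

section Canonical

variable {Ω : Type*} [MeasurableSpace Ω] {P : Measure Ω} {ξ : ℤ → Ω → ℂ} {n : ℕ} {F : Measure ℝ}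
  [IsFiniteMeasure F] {h : StationaryIncrements P ξ n} {V : Lp ℂ 2 F →ₗᵢ[ℂ] Lp ℂ 2 P}

theorem pastSpace_eq_map (hV : ∀ m μ, V (specLp F n m μ) = h.incrLp m μ) (t : ℤ) :
    h.pastSpace t = (specPast F n 1 t).map V.toLinearMap := by
  rw [map_closedSpan]
  refine le_antisymm (closedSpan_le (isClosed_closedSpan _) ?_) (closedSpan_mono ?_)
  · rintro _ ⟨m, μ, hm, hμ, rfl⟩
    rw [← map_closedSpan, ← hV]
    exact ⟨_, specLp_mem_specPast_one hμ hm, rfl⟩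
  · rintro _ ⟨_, ⟨m, hm, rfl⟩, rfl⟩
    exact ⟨m, 1, hm, one_pos, hV m 1⟩

theorem obsSpace_eq_pastSpace (hV : ∀ m μ, V (specLp F n m μ) = h.incrLp m μ) {ρ : ℝ → ℝ}
    {c C : ℝ} (hF : HasBoundedDensity F ρ c C) {μ : ℤ} (hμ : 0 < μ) (t : ℤ) :
    h.obsSpace μ t = h.pastSpace t := by
  rw [pastSpace_eq_map hV, ← hF.specPast_eq hμ, map_closedSpan, StationaryIncrements.obsSpace]
  congr 2
  ext X
  constructor
  · rintro ⟨m, hm, rfl⟩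
    exact ⟨_, ⟨m, hm, rfl⟩, hV m μ⟩
  · rintro ⟨_, ⟨m, hm, rfl⟩, rfl⟩
    exact ⟨m, hm, hV m μ⟩

/-- Expectation is the inner product with the constant 1, so its vanishing passes from the
increments to their closed span. -/
theorem integral_eq_zero_of_mem_pastSpace [IsProbabilityMeasure P]
    (hmean : ∀ m μ : ℤ, ∫ ω, incr ξ n m μ ω ∂P = 0) {t : ℤ} {X : Lp ℂ 2 P}
    (hX : X ∈ h.pastSpace t) : ∫ ω, X ω ∂P = 0 := by
  have h1 : ∀ Y : Lp ℂ 2 P, inner ℂ (indicatorConstLp 2 MeasurableSet.univ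
      (measure_ne_top P Set.univ) (1 : ℂ)) Y = ∫ ω, Y ω ∂P := fun Y => by
    rw [L2.inner_indicatorConstLp_one, Measure.restrict_univ]
  rw [← h1]
  refine inner_eq_zero_symm.1 (inner_eq_zero_of_mem_closedSpan ?_ hX)
  rintro _ ⟨m, μ, -, -, rfl⟩
  rw [inner_eq_zero_symm, h1, ← hmean m μ]
  exact integral_congr_ae (h.coeFn_incrLp m μ)

/-- The Wold decomposition is carried out in L₂(F) for the unit step, with multiplication by e^{ijx}
as shift, and transported by `V`. -/
theorem exists_isCanonicalRepresentation [IsProbabilityMeasure P]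
    (hmean : ∀ m μ : ℤ, ∫ ω, incr ξ n m μ ω ∂P = 0)
    (hV : ∀ m μ, V (specLp F n m μ) = h.incrLp m μ) {ρ : ℝ → ℝ}
    {c C : ℝ} (hF : HasBoundedDensity F ρ c C) {μ : ℤ} (hμ : 0 < μ) :
    ∃ (ε : ℤ → Lp ℂ 2 P) (φμ : EllTwo), IsCanonicalRepresentation h μ ε φμ := by
  obtain ⟨d, hd, htot⟩ := hF.exists_biorthogonal (n := n)
  have hSa : ∀ m, expShift F m (specLp F n 0 1) = specLp F n m 1 := fun m => by
    rw [expShift_specLp, add_zero]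
  obtain ⟨v, hv, hpast⟩ := exists_innovation (expShift F) expShift_expShift expShift_zero
    (specLp F n 0 1) d (fun j m hjm => by rw [hSa, hd, if_neg hjm])
    (by rw [hd, if_pos rfl]; simp [Real.pi_ne_zero]) htot
  simp_rw [hSa] at hpast
  have hpastV : ∀ t, h.pastSpace t =
      closedSpan {X | ∃ m : ℤ, m ≤ t ∧ X = V (expShift F m v)} := by
    intro t
    rw [pastSpace_eq_map hV, specPast, hpast, map_closedSpan]
    congr 2
    ext X
    constructor
    · rintro ⟨_, ⟨m, hm, rfl⟩, rfl⟩
      exact ⟨m, hm, rfl⟩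
    · rintro ⟨m, hm, rfl⟩
      exact ⟨_, ⟨m, hm, rfl⟩, rfl⟩
  have horth : Orthonormal ℂ fun k : ℕ => expShift F (-(k : ℤ)) v :=
    hv.comp (fun k : ℕ => -(k : ℤ)) fun i j hij => by simpa using hij
  obtain ⟨W, hW, hWr⟩ := horth.exists_linearIsometry_ellTwo
  -- The step `μ` increment at time 0 lies in the unit step past and so expands in the innovations
  -- at times -k. Shifting the expansion serves all other times.
  obtain ⟨φμ, hφμ⟩ := hWr (specLp F n 0 μ) (by
    have h1 : specLp F n 0 μ ∈ specPast F n 1 0 := specLp_mem_specPast_one hμ le_rfl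
    rw [specPast, hpast] at h1
    refine closedSpan_mono ?_ h1
    rintro _ ⟨m, hm, rfl⟩
    refine ⟨(-m).toNat, ?_⟩
    change expShift F (-((-m).toNat : ℤ)) v = _
    rw [Int.toNat_of_nonneg (by omega), neg_neg])
  refine ⟨fun m => V (expShift F m v), φμ, ⟨⟨fun m => ?_, fun m k => ?_, hpastV⟩, fun m => ?_⟩⟩
  · refine integral_eq_zero_of_mem_pastSpace (h := h) (t := m) hmean ?_
    rw [hpastV]
    exact subset_closedSpan ⟨m, le_rfl, rfl⟩
  · rw [← inner_eq_integral (EventuallyEq.refl _ _) (EventuallyEq.refl _ _), V.inner_map_map,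
      orthonormal_iff_ite.1 hv]
    simp [eq_comm]
  · have h1 := hW φμ
    rw [hφμ] at h1
    have h2 := (h1.mapL (expShift F m).toContinuousLinearMap).mapL V.toContinuousLinearMap
    simp only [LinearIsometry.coe_toContinuousLinearMap, map_smul, expShift_expShift,
      expShift_specLp, add_zero, hV] at h2
    exact h2

end Canonical

/-! ### Boundedness of the Hankel operator. -/

section Hankel

/-- The antidiagonal k + j = m has m + 1 entries, which accounts for the weight. -/
theorem summable_norm_sq_add {b : ℕ → ℂ} (hb : Summable fun k : ℕ => ((k : ℝ) + 1) * ‖b k‖ ^ 2) :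
    Summable fun p : ℕ × ℕ => ‖b (p.1 + p.2)‖ ^ 2 := by
  rw [← Finset.HasAntidiagonal.sigmaAntidiagonalEquivProd.summable_iff, summable_sigma_of_nonneg]
  · refine ⟨fun m => Summable.of_finite, hb.congr fun m => ?_⟩
    rw [tsum_fintype]
    have : ∀ p : Finset.HasAntidiagonal.antidiagonal m,
        ((fun p : ℕ × ℕ => ‖b (p.1 + p.2)‖ ^ 2) ∘ Finset.HasAntidiagonal.sigmaAntidiagonalEquivProd) ⟨m, p⟩ =
          ‖b m‖ ^ 2 := fun p => by
      have := Finset.HasAntidiagonal.mem_antidiagonal.1 p.2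
      simp [this]
    simp_rw [this]
    simp
  · exact fun _ => sq_nonneg _

theorem norm_sq_ellTwo (x : EllTwo) : HasSum (fun k => ‖x k‖ ^ 2) (‖x‖ ^ 2) := by
  have := lp.hasSum_norm (p := 2) (by norm_num) x
  simpa using this

theorem memℓp_two_iff {x : ℕ → ℂ} : Memℓp x 2 ↔ Summable fun k => ‖x k‖ ^ 2 := by
  rw [memℓp_gen_iff (by norm_num)]
  simp

/-- The matrix is Hilbert–Schmidt: entries of the image are inner products with the rows, and
Cauchy–Schwarz bounds the norm. The rows are conjugated because the inner product is conjugate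
linear in its first argument. -/
theorem exists_isHankelOperator {b : ℕ → ℂ}
    (hb : Summable fun k : ℕ => ((k : ℝ) + 1) * ‖b k‖ ^ 2) :
    ∃ T : EllTwo →L[ℂ] EllTwo, IsHankelOperator b T := by
  have hs := summable_norm_sq_add hb
  obtain ⟨hrow, hsum⟩ := (summable_prod_of_nonneg fun _ => by positivity).1 hs
  have hmem : ∀ k, Memℓp (fun j => conj (b (k + j))) 2 := fun k => by
    rw [memℓp_two_iff]
    simpa using hrow k
  let β : ℕ → EllTwo := fun k => ⟨fun j => conj (b (k + j)), hmem k⟩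
  have hβ : ∀ k, ‖β k‖ ^ 2 = ∑' j, ‖b (k + j)‖ ^ 2 := fun k => by
    rw [← (norm_sq_ellTwo (β k)).tsum_eq]
    refine tsum_congr fun j => ?_
    change ‖conj (b (k + j))‖ ^ 2 = _
    rw [RCLike.norm_conj]
  have hβs : Summable fun k => ‖β k‖ ^ 2 := hsum.congr fun k => (hβ k).symm
  have hle : ∀ (x : EllTwo) (k : ℕ), ‖inner ℂ (β k) x‖ ^ 2 ≤ ‖β k‖ ^ 2 * ‖x‖ ^ 2 := fun x k => by
    rw [← mul_pow]
    exact pow_le_pow_left₀ (norm_nonneg _) (norm_inner_le_norm _ _) 2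
  have hT : ∀ x : EllTwo, Memℓp (fun k => inner ℂ (β k) x) 2 := fun x => by
    rw [memℓp_two_iff]
    exact (hβs.mul_right (‖x‖ ^ 2)).of_nonneg_of_le (fun k => by positivity) (hle x)
  let T : EllTwo →ₗ[ℂ] EllTwo :=
    { toFun := fun x => ⟨fun k => inner ℂ (β k) x, hT x⟩
      map_add' := fun x y => by ext k; exact inner_add_right _ _ _
      map_smul' := fun c x => by ext k; exact inner_smul_right _ _ _ }
  refine ⟨T.mkContinuous √(∑' k, ‖β k‖ ^ 2) fun x => ?_, fun x k => ?_⟩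
  · refine (pow_le_pow_iff_left₀ (norm_nonneg _) (by positivity) two_ne_zero).1 ?_
    change ‖T x‖ ^ 2 ≤ _
    rw [mul_pow, Real.sq_sqrt (tsum_nonneg fun k => by positivity), ← tsum_mul_right,
      ← (norm_sq_ellTwo (T x)).tsum_eq]
    exact (norm_sq_ellTwo (T x)).summable.tsum_le_tsum (hle x) (hβs.mul_right _)
  · have h1 := lp.hasSum_inner (𝕜 := ℂ) (β k) x
    have h2 : ∀ j, inner ℂ (β k j) (x j) = b (k + j) * x j := fun j => by
      change x j * conj (conj (b (k + j))) = _
      rw [Complex.conj_conj, mul_comm]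
    simp_rw [h2] at h1
    exact h1

end Hankel

/-! ### Optimal estimates as orthogonal projections. -/

section Optimal

variable {Ω : Type*} [MeasurableSpace Ω] {P : Measure Ω}

theorem mse_eq_norm_sq (X Y : Lp ℂ 2 P) : mse X Y = ‖X - Y‖ ^ 2 := by
  rw [norm_sq_eq_integral, mse]
  refine integral_congr_ae ?_
  filter_upwards [Lp.coeFn_sub X Y] with ω hω
  rw [hω, Pi.sub_apply]

theorem norm_sub_sq_eq_starProjection {E : Type*} [NormedAddCommGroup E] [InnerProductSpace ℂ E]
    (K : Submodule ℂ E) [K.HasOrthogonalProjection] (X : E) {W : E} (hW : W ∈ K) :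
    ‖X - W‖ ^ 2 = ‖X - K.starProjection X‖ ^ 2 + ‖K.starProjection X - W‖ ^ 2 := by
  have h1 : inner ℂ (X - K.starProjection X) (K.starProjection X - W) = 0 :=
    (Submodule.mem_orthogonal' _ _).1 (K.sub_starProjection_mem_orthogonal X) _
      (K.sub_mem (K.starProjection_apply_mem X) hW)
  rw [← sub_add_sub_cancel X (K.starProjection X) W, @norm_add_sq ℂ, h1]
  simp

theorem isOptimalEstimate_iff (K : Submodule ℂ (Lp ℂ 2 P)) [K.HasOrthogonalProjection]
    (X Y : Lp ℂ 2 P) : IsOptimalEstimate K X Y ↔ Y = K.starProjection X := by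
  simp only [IsOptimalEstimate, mse_eq_norm_sq]
  constructor
  · rintro ⟨hY, hmin⟩
    have h1 := hmin _ (K.starProjection_apply_mem X)
    rw [norm_sub_sq_eq_starProjection K X hY] at h1
    have h2 : ‖K.starProjection X - Y‖ ^ 2 = 0 :=
      le_antisymm (by linarith) (by positivity)
    exact (sub_eq_zero.1 (norm_eq_zero.1 (pow_eq_zero_iff two_ne_zero |>.1 h2))).symm
  · rintro rfl
    refine ⟨K.starProjection_apply_mem X, fun W hW => ?_⟩
    rw [norm_sub_sq_eq_starProjection K X hW]
    exact le_add_of_nonneg_right (by positivity)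

end Optimal

/-! ### Multipliers from L₂(-π, π) to L₂(F). -/

section BoundedDensity

variable {F : Measure ℝ} {ρ : ℝ → ℝ} {c C : ℝ}

/-- Orthonormality says that |v|² ρ has the Fourier coefficients of the constant 1/(2π), so |v|² =
1/(2πρ). The bound makes multiplication by `v` an operator from L₂(-π, π) to L₂(F). -/
theorem HasBoundedDensity.norm_le_of_orthonormal (hF : HasBoundedDensity F ρ c C) {v : Lp ℂ 2 F}
    (hv : Orthonormal ℂ fun m => expShift F m v) : ∀ᵐ x ∂F, ‖v x‖ ≤ √((2 * Real.pi * c)⁻¹) := by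
  have hρ : ∀ x, (ρ x : ℂ) ≠ 0 := fun x => by exact_mod_cast (hF.ρ_pos x).ne'
  have h1 : Integrable (fun x => conj (v x) * v x) F :=
    integrable_conj_mul (Lp.memLp v) (Lp.memLp v)
  have h2 : Integrable (fun x => ((2 * Real.pi : ℂ) * ρ x)⁻¹) F := by
    rw [hF.integrable_iff]
    refine (integrable_const ((2 * Real.pi : ℂ)⁻¹)).congr (Eventually.of_forall fun x => ?_)
    have := hρ x
    field_simp
  have hb : ∀ (j : ℤ) {g : ℝ → ℂ}, Integrable g F →
      Integrable (fun x : ℝ => Complex.exp (Complex.I * j * x) * g x) F := fun j g hg =>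
    hg.bdd_mul (measurable_exp_I_mul j).aestronglyMeasurable (c := 1)
      (Eventually.of_forall fun x => (norm_exp_I_mul_int j x).le)
  have hpi : (2 * Real.pi : ℂ) ≠ 0 := by simp [Real.pi_ne_zero]
  have h0 := hF.ae_eq_zero_of_integral_exp (h1.sub h2) fun j => by
    simp only [Pi.sub_apply, mul_sub]
    rw [integral_sub (hb j h1) (hb j h2), sub_eq_zero]
    have e1 : ∫ x, Complex.exp (Complex.I * j * x) * (conj (v x) * v x) ∂F =
        inner ℂ (expShift F (-j) v) (expShift F 0 v) := by
      rw [inner_eq_integral (coeFn_expShift F (-j) v) (coeFn_expShift F 0 v)]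
      congr 1; ext x
      rw [map_mul, conj_exp_I_mul, neg_neg]
      simp; ring
    have e2 : ∫ x, Complex.exp (Complex.I * j * x) * ((2 * Real.pi : ℂ) * ρ x)⁻¹ ∂F =
        (2 * Real.pi : ℂ)⁻¹ * ∫ x, Complex.exp (Complex.I * j * x) ∂lebPi := by
      rw [hF.integral_eq, ← integral_const_mul]
      congr 1; ext x
      have := hρ x
      field_simp
    rw [e1, e2, orthonormal_iff_ite.1 hv, integral_exp_lebPi]
    by_cases hj : j = 0
    · simp only [hj, neg_zero, if_true]
      exact (inv_mul_cancel₀ hpi).symm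
    · simp [hj]
  filter_upwards [h0] with x hx
  refine Real.le_sqrt_of_sq_le ?_
  have h3 : ((‖v x‖ ^ 2 : ℝ) : ℂ) = ((2 * Real.pi * ρ x)⁻¹ : ℝ) := by
    rw [Pi.zero_apply, Pi.sub_apply, sub_eq_zero, mul_comm, Complex.mul_conj,
      Complex.normSq_eq_norm_sq] at hx
    rw [hx]; push_cast; rfl
  rw [Complex.ofReal_injective h3]
  have := hF.pos
  have := hF.lower x
  have := Real.pi_pos
  gcongr

theorem HasBoundedDensity.exists_mul_clm_lebPi (hF : HasBoundedDensity F ρ c C) {w : ℝ → ℂ}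
    (hw : AEStronglyMeasurable w F) {K : ℝ} (hK : ∀ᵐ x ∂F, ‖w x‖ ≤ K) :
    ∃ A : Lp ℂ 2 lebPi →L[ℂ] Lp ℂ 2 F, (∀ g, A g =ᵐ[F] fun x => w x * g x) ∧
      ∀ j, A (expLp j) =ᵐ[F] fun x => Complex.exp (Complex.I * j * x) * w x := by
  obtain ⟨A, hA⟩ := exists_mul_clm ENNReal.ofReal_ne_top hF.le_smul hw hK
  refine ⟨A, hA, fun j => ?_⟩
  filter_upwards [hA (expLp j), hF.absolutelyContinuous.ae_le (coeFn_expLp j)] with x h1 h2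
  rw [h1, h2, mul_comm]

end BoundedDensity

/-! ### Arbitrary canonical representations and the prediction error. -/

section Representation

variable {Ω : Type*} [MeasurableSpace Ω] {P : Measure Ω} {ξ : ℤ → Ω → ℂ} {n : ℕ} {F : Measure ℝ}
  [IsFiniteMeasure F] {h : StationaryIncrements P ξ n} {V : Lp ℂ 2 F →ₗᵢ[ℂ] Lp ℂ 2 P}
  {ρ : ℝ → ℝ} {c C : ℝ} {μ : ℤ} {ε : ℤ → Lp ℂ 2 P} {φμ : EllTwo}

theorem IsInnovation.inner_eq (hε : IsInnovation h ε) (j m : ℤ) :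
    inner ℂ (ε j) (ε m) = if m = j then (1 : ℂ) else 0 := by
  rw [inner_eq_integral (EventuallyEq.refl _ _) (EventuallyEq.refl _ _), hε.uncorrelated]

theorem IsInnovation.orthonormal (hε : IsInnovation h ε) : Orthonormal ℂ ε := by
  rw [orthonormal_iff_ite]
  intro i j
  rw [hε.inner_eq]
  simp [eq_comm]

theorem IsCanonicalRepresentation.hasSum_inner (hc : IsCanonicalRepresentation h μ ε φμ)
    (j m : ℤ) : HasSum (fun k : ℕ => φμ k * if m - k = j then (1 : ℂ) else 0)
      (inner ℂ (ε j) (h.incrLp m μ)) := by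
  have := (hc.hasSum m).mapL (innerSL ℂ (ε j))
  simpa only [innerSL_apply_apply, inner_smul_right, hc.innovation.inner_eq] using this

theorem hasSum_mul_ite {a : ℕ → ℂ} {p : ℕ → Prop} [DecidablePred p] {k : ℕ}
    (hp : ∀ i, p i ↔ i = k) : HasSum (fun i => a i * if p i then (1 : ℂ) else 0) (a k) := by
  have := hasSum_single (f := fun i => a i * if p i then (1 : ℂ) else 0) k fun i hi => by
    rw [if_neg fun h => hi ((hp i).1 h), mul_zero]
  rwa [if_pos ((hp k).2 rfl), mul_one] at this

theorem IsCanonicalRepresentation.inner_of_lt (hc : IsCanonicalRepresentation h μ ε φμ)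
    {j m : ℤ} (hjm : m < j) : inner ℂ (ε j) (h.incrLp m μ) = 0 := by
  refine (hc.hasSum_inner j m).unique ?_
  convert! hasSum_zero using 2 with k
  rw [if_neg (by omega), mul_zero]

theorem IsCanonicalRepresentation.inner_add (hc : IsCanonicalRepresentation h μ ε φμ)
    (j : ℤ) (k : ℕ) : inner ℂ (ε j) (h.incrLp (j + k) μ) = φμ k := by
  exact (hc.hasSum_inner j (j + k)).unique (hasSum_mul_ite fun i => by omega)

/-- The innovations of a canonical representation are the spectral images of the shifts of a single
element of `L₂(F)`. -/
theorem IsCanonicalRepresentation.exists_spectral (hc : IsCanonicalRepresentation h μ ε φμ)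
    (hF : HasBoundedDensity F ρ c C) (hμ : 0 < μ)
    (hV : ∀ m μ, V (specLp F n m μ) = h.incrLp m μ) :
    ∃ v : Lp ℂ 2 F, ∀ m, ε m = V (expShift F m v) := by
  have hex : ∀ m, ∃ v, V v = ε m := by
    intro m
    have h1 : ε m ∈ h.pastSpace m := by
      rw [hc.innovation.past_eq]
      exact subset_closedSpan ⟨m, le_rfl, rfl⟩
    rw [pastSpace_eq_map hV] at h1
    obtain ⟨v, -, hv⟩ := h1
    exact ⟨v, hv⟩
  choose v hv using hex
  refine ⟨v 0, fun j => ?_⟩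
  rw [← hv j]
  congr 1
  rw [← sub_eq_zero]
  -- The product of ε(j) with the increment at `m` depends only on m - j, so the preimage of ε(j)
  -- and the shifted preimage of ε(0) pair equally with a total family.
  refine hF.eq_zero_of_inner_specLp (n := n) hμ fun m => ?_
  rw [inner_eq_zero_symm, inner_sub_left, sub_eq_zero, inner_expShift, expShift_specLp,
    ← V.inner_map_map, ← V.inner_map_map, hv, hv, hV, hV]
  refine (hc.hasSum_inner j m).unique ?_
  have hiff : ∀ k : ℕ, m - (k : ℤ) = j ↔ -j + m - (k : ℤ) = 0 := fun k => by omega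
  simpa only [hiff] using hc.hasSum_inner 0 (-j + m)

/-- Both sides lie in the range of `V`, where the innovations are total, so it suffices to pair with
each ε(m). Times m < 0 give zero on both sides; for m ≥ 0 the estimate drops out and Bξ contributes
entry m of `T φμ`. -/
theorem IsCanonicalRepresentation.eq_residual (hc : IsCanonicalRepresentation h μ ε φμ)
    (hF : HasBoundedDensity F ρ c C) (hμ : 0 < μ)
    (hV : ∀ m μ, V (specLp F n m μ) = h.incrLp m μ) {b : ℕ → ℂ} {T : EllTwo →L[ℂ] EllTwo}
    (hT : IsHankelOperator b T) {Bξ Best R : Lp ℂ 2 P}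
    (hB : HasSum (fun k : ℕ => b k • h.incrLp k μ) Bξ) (hBV : ∃ y, V y = Bξ)
    (hBest : Best ∈ h.pastSpace (-1)) (horth : ∀ X ∈ h.pastSpace (-1), inner ℂ X (Bξ - Best) = 0)
    (hR : HasSum (fun j : ℕ => T φμ j • ε j) R) : Bξ - Best = R := by
  have hVm : ∀ m, ∃ y, V y = ε m := fun m =>
    (hc.exists_spectral hF hμ hV).elim fun v hv => ⟨_, (hv m).symm⟩
  have hrange : IsClosed (LinearMap.range V.toLinearMap : Set (Lp ℂ 2 P)) :=
    V.isometry.isClosedEmbedding.isClosed_range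
  have hRV : R ∈ LinearMap.range V.toLinearMap :=
    hrange.mem_of_tendsto hR (Eventually.of_forall fun s =>
      Submodule.sum_mem _ fun j _ => Submodule.smul_mem _ _ (hVm j))
  have hBestV : Best ∈ LinearMap.range V.toLinearMap := by
    rw [pastSpace_eq_map hV] at hBest
    obtain ⟨y, -, hy⟩ := hBest
    exact ⟨y, hy⟩
  have hεR : ∀ m : ℤ, HasSum (fun j : ℕ => T φμ j * if (j : ℤ) = m then (1 : ℂ) else 0)
      (inner ℂ (ε m) R) := fun m => by
    have := hR.mapL (innerSL ℂ (ε m))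
    simpa only [innerSL_apply_apply, inner_smul_right, hc.innovation.inner_eq] using this
  have hpast : ∀ m : ℤ, m ≤ -1 → ε m ∈ h.pastSpace (-1) := fun m hm => by
    rw [hc.innovation.past_eq]
    exact subset_closedSpan ⟨m, hm, rfl⟩
  have key : ∀ m, inner ℂ (ε m) (Bξ - Best - R) = 0 := by
    intro m
    rw [inner_sub_right, sub_eq_zero]
    rcases lt_or_ge m 0 with hm | hm
    · rw [horth _ (hpast m (by omega))]
      refine HasSum.unique ?_ (hεR m)
      convert! hasSum_zero using 2 with j
      rw [if_neg (by omega), mul_zero]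
    · lift m to ℕ using hm
      have h1 : inner ℂ (ε m) R = T φμ m :=
        (hεR m).unique (hasSum_mul_ite fun i => Nat.cast_inj)
      have h2 : inner ℂ (ε m) Best = 0 := by
        rw [inner_eq_zero_symm]
        rw [hc.innovation.past_eq] at hBest
        refine inner_eq_zero_of_mem_closedSpan ?_ hBest
        rintro _ ⟨k, hk, rfl⟩
        rw [hc.innovation.inner_eq, if_neg (by omega)]
      have h3 : HasSum (fun k : ℕ => b k * inner ℂ (ε m) (h.incrLp k μ)) (inner ℂ (ε m) Bξ) := by
        have := hB.mapL (innerSL ℂ (ε m))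
        simpa only [innerSL_apply_apply, inner_smul_right] using this
      -- Increments before time `m` are orthogonal to ε(m). Dropping them and reindexing by m + k
      -- turns the series into row `m` of the Hankel matrix applied to `φμ`.
      rw [← (add_right_injective m).hasSum_iff] at h3
      · rw [inner_sub_right, h2, sub_zero, h1]
        refine h3.unique ?_
        convert! hT φμ m using 2 with k
        simp only [Function.comp_apply]
        rw [Nat.cast_add, hc.inner_add]
      · intro k hk
        have hkm : k < m := by
          by_contra hle
          exact hk ⟨k - m, by dsimp only; omega⟩
        rw [hc.inner_of_lt (by exact_mod_cast hkm), mul_zero]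
  -- A vector orthogonal to all innovations is orthogonal to every increment, by the moving average
  -- expansion; in the range of `V` it is therefore zero.
  obtain ⟨y, hy⟩ : Bξ - Best - R ∈ LinearMap.range V.toLinearMap :=
    Submodule.sub_mem _ (Submodule.sub_mem _ hBV hBestV) hRV
  have hy' : V y = Bξ - Best - R := hy
  rw [← sub_eq_zero, ← hy']
  rw [hF.eq_zero_of_inner_specLp (n := n) (g := y) hμ fun k => ?_, map_zero]
  rw [← V.inner_map_map, hV, hy']
  have := (hc.hasSum k).mapL (innerSL ℂ (Bξ - Best - R))
  simp only [innerSL_apply_apply, inner_smul_right, inner_eq_zero_symm.1 (key _), mul_zero] at this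
  exact inner_eq_zero_symm.1 (this.unique hasSum_zero)

end Representation

end StatIncr

/-! ### The theorem. -/

theorem theorem3p1 {Ω : Type*} [MeasurableSpace Ω] (P : Measure Ω) [IsProbabilityMeasure P]
    (ξ : ℤ → Ω → ℂ) (n : ℕ) (hξ : StationaryIncrements P ξ n)
    (hmean : ∀ m μ' : ℤ, ∫ ω, incr ξ n m μ' ω ∂P = 0)
    (f : ℝ → ℝ) (hf : IsSpectralMeasure P ξ n (densityMeasure f))
    (φ : ℕ → ℂ) (hφ : IsCanonicalFactorization f φ)
    (μ : ℤ) (hμ : 0 < μ)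
    (b : ℕ → ℂ) (hb : Summable fun k => ‖b k‖)
    (hb' : Summable fun k : ℕ => ((k : ℝ) + 1) * ‖b k‖ ^ 2) :
    (∃ Z : Set ℝ → Lp ℂ 2 P, IsSpectralRepresentation hξ (densityMeasure f) Z) ∧
    (∃ (ε : ℤ → Lp ℂ 2 P) (φμ : EllTwo), IsCanonicalRepresentation hξ μ ε φμ) ∧
    ∃ T : EllTwo →L[ℂ] EllTwo, IsHankelOperator b T ∧
    ∃ Bξ : Lp ℂ 2 P, HasSum (fun k : ℕ => b k • hξ.incrLp k μ) Bξ ∧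
    ∃ Best : Lp ℂ 2 P,
      IsOptimalEstimate (hξ.obsSpace μ (-1)) Bξ Best ∧
      (∀ Y, IsOptimalEstimate (hξ.obsSpace μ (-1)) Bξ Y → Y = Best) ∧
      IsOptimalEstimate (hξ.pastSpace (-1)) Bξ Best ∧
      ∀ (ε : ℤ → Lp ℂ 2 P) (φμ : EllTwo), IsCanonicalRepresentation hξ μ ε φμ →
        (∀ᵐ x ∂lebPi, expSeries (-1) φμ x ≠ 0) ∧
        (∀ Z : Set ℝ → Lp ℂ 2 P, IsSpectralRepresentation hξ (densityMeasure f) Z →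
          ∀ h : ℝ → ℂ, IsSpectralCharacteristic (densityMeasure f) Z n μ h Best ↔
            h =ᵐ[lebPi] optimalCharacteristic b T φμ) ∧
        mse Bξ Best = (2 * Real.pi)⁻¹ * ∫ x, ‖expSeries 1 (T φμ) x‖ ^ 2 ∂lebPi ∧
        mse Bξ Best = ‖T φμ‖ ^ 2 := by
  obtain ⟨ρ, c, C, hF⟩ := hφ.exists_hasBoundedDensity
  set F := densityMeasure f
  have hfin : IsFiniteMeasure F := hF.isFiniteMeasure
  obtain ⟨V, hV⟩ := exists_spectralIsometry hξ hf hF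
  obtain ⟨T, hT⟩ := exists_isHankelOperator hb'
  obtain ⟨A, hA, hAe⟩ := hF.exists_mul_clm_lebPi (w := incrKernel n μ)
    (measurable_incrKernel n μ).aestronglyMeasurable
    (Eventually.of_forall (norm_incrKernel_le n μ))
  have hAspec : ∀ j, A (expLp j) = specLp F n j μ := fun j =>
    Lp.ext ((hAe j).trans (coeFn_specLp F n j μ).symm)
  have hB : HasSum (fun k : ℕ => b k • hξ.incrLp k μ) (V (A (expSeries 1 b))) := by
    have h1 := ((hasSum_expSeries_of_summable 1 hb).mapL A).mapL V.toContinuousLinearMap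
    simpa only [map_smul, hAspec, LinearIsometry.coe_toContinuousLinearMap, hV, one_mul] using h1
  have hobs := obsSpace_eq_pastSpace hV hF hμ (-1)
  have hcomp : CompleteSpace (hξ.pastSpace (-1)) := (isClosed_closedSpan _).completeSpace_coe
  refine ⟨exists_isSpectralRepresentation hV,
    exists_isCanonicalRepresentation hmean hV hF hμ, T, hT, _, hB,
    (hξ.pastSpace (-1)).starProjection (V (A (expSeries 1 b))), ?_, ?_, ?_, ?_⟩
  · rw [hobs, isOptimalEstimate_iff]
  · rw [hobs]
    exact fun Y hY => (isOptimalEstimate_iff _ _ _).1 hY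
  · rw [isOptimalEstimate_iff]
  intro ε φμ hc
  set Bξ := V (A (expSeries 1 b))
  set Best := (hξ.pastSpace (-1)).starProjection Bξ
  obtain ⟨v, hv⟩ := hc.exists_spectral hF hμ hV
  have hvorth : Orthonormal ℂ fun m => expShift F m v := by
    have := hc.innovation.orthonormal
    rw [orthonormal_iff_ite] at this ⊢
    intro i j
    rw [← this i j, hv, hv, V.inner_map_map]
  obtain ⟨M, hM, hMe⟩ := hF.exists_mul_clm_lebPi (w := v) (Lp.aestronglyMeasurable v)
    (hF.norm_le_of_orthonormal hvorth)
  have hMv : ∀ j, V (M (expLp j)) = ε j := fun j => by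
    rw [hv]
    exact congrArg V (Lp.ext ((hMe j).trans (coeFn_expShift F j v).symm))
  have hsumε : ∀ {s : ℤ}, s ≠ 0 → ∀ a : EllTwo,
      HasSum (fun k : ℕ => a k • ε (s * k)) (V (M (expSeries s a))) := fun hs a => by
    have h1 := ((hasSum_expSeries hs a).1.mapL M).mapL V.toContinuousLinearMap
    simpa only [map_smul, LinearIsometry.coe_toContinuousLinearMap, hMv] using h1
  -- The moving average at time 0 pulled back along `V`; pointwise it is the factorization K_μ = v
  -- Φ_μ.
  have hkernel : specLp F n 0 μ = M (expSeries (-1) φμ) := by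
    refine V.injective ?_
    rw [hV]
    refine (hc.hasSum 0).unique ?_
    convert! hsumε (s := -1) (by norm_num) φμ using 4
    ring
  have hfactor : ∀ᵐ x ∂F, incrKernel n μ x = v x * expSeries (-1) φμ x := by
    filter_upwards [coeFn_specLp F n 0 μ, hM (expSeries (-1) φμ)] with x h1 h2
    rw [← h2, ← hkernel, h1]
    simp
  have hΦ : ∀ᵐ x ∂lebPi, expSeries (-1) φμ x ≠ 0 := by
    filter_upwards [hF.absolutelyContinuous'.ae_le hfactor, ae_incrKernel_ne_zero n hμ]
      with x h1 h2 h3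
    exact h2 (by rw [h1, h3, mul_zero])
  have hR : HasSum (fun j : ℕ => T φμ j • ε j) (V (M (expSeries 1 (T φμ)))) := by
    simpa only [one_mul] using hsumε one_ne_zero (T φμ)
  have hres : Bξ - Best = V (M (expSeries 1 (T φμ))) :=
    hc.eq_residual hF hμ hV hT hB ⟨_, rfl⟩ (Submodule.starProjection_apply_mem _ _)
      (fun X hX => (Submodule.mem_orthogonal _ _).1
        (Submodule.sub_starProjection_mem_orthogonal Bξ) X hX) hR
  have hmse : mse Bξ Best = ‖T φμ‖ ^ 2 := by
    have horth : Orthonormal ℂ fun k : ℕ => ε k :=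
      hc.innovation.orthonormal.comp _ Nat.cast_injective
    obtain ⟨W, hW, -⟩ := horth.exists_linearIsometry_ellTwo
    rw [mse_eq_norm_sq, hres, hR.unique (hW (T φμ)), W.norm_map]
  refine ⟨hΦ, fun Z hZ g => ?_, ?_, hmse⟩
  swap
  · rw [hmse, integral_norm_sq_expSeries one_ne_zero]
  -- The spectral image of the estimate, B^μ K_μ - r_μ v. Substituting K_μ = v Φ_μ, with Φ_μ ≠ 0,
  -- shows that it equals h_μ K_μ.
  set G : Lp ℂ 2 F := A (expSeries 1 b) - M (expSeries 1 (T φμ))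
  have hBestG : Best = V G := by
    rw [map_sub, ← hres, sub_sub_cancel]
  have hG : G =ᵐ[F] fun x => optimalCharacteristic b T φμ x * incrKernel n μ x := by
    filter_upwards [Lp.coeFn_sub (A (expSeries 1 b)) (M (expSeries 1 (T φμ))),
      hA (expSeries 1 b), hM (expSeries 1 (T φμ)), hfactor, hF.absolutelyContinuous.ae_le hΦ]
      with x h1 h2 h3 h4 h5
    rw [h1, Pi.sub_apply, h2, h3, h4, optimalCharacteristic]
    field_simp
  -- Lebesgue measure and `F` have the same null sets and K_μ is nonzero almost everywhere, so the
  -- characteristic is recovered from its product with K_μ.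
  have hiff : g =ᵐ[lebPi] optimalCharacteristic b T φμ ↔
      (fun x => g x * incrKernel n μ x) =ᵐ[F] G := by
    constructor
    · intro hg
      filter_upwards [hG, hF.absolutelyContinuous.ae_le hg] with x h1 h2
      rw [h1, h2]
    · intro hg
      filter_upwards [hF.absolutelyContinuous'.ae_le hG, hF.absolutelyContinuous'.ae_le hg,
        ae_incrKernel_ne_zero n hμ] with x h1 h2 h3
      exact mul_right_cancel₀ h3 (h2.trans h1)
  rw [hiff, IsSpectralCharacteristic, hZ.hasStochIntegral_iff hF hV, hBestG]
  constructor
  · rintro ⟨hg, hVg⟩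
    rw [V.injective hVg]
    exact hg.coeFn_toLp.symm
  · intro hg
    refine ⟨(memLp_congr_ae hg).2 (Lp.memLp G), ?_⟩
    congr 1
    exact Lp.ext (hg.symm.trans (MemLp.coeFn_toLp _).symm)
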